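/- **Setting.** Consider a nonstationary $K$-armed bandit with $K\ge 1$ arms, horizon $T\ge 2$ and mean rewards $\mu_t(a)\in[0,1]$, for $t\in\{1,\dots,T\}$ and $a\in[K]$, and assume $K\le cT$ for a constant $c$. If arm $a_t$ is pulled in round $t$, the learner observes $r_t=\mu_t(a_t)+\xi_t(a_t)$, where the noise vectors $\xi_t=(\xi_t(a))_{a\in[K]}$, $t\ge1$, are independent and every $\xi_t(a)$ is zero-mean and $1$-sub-Gaussian, i.e. $\mathbb E\,e^{\lambda \xi_t(a)}\le e^{\lambda^2/2}$ for all $\lambda\in\mathbb R$ (nothing is assumed about the dependence between the coordinates of one $\xi_t$; in particular the noise may be the same for all arms). Let $$L:=1+\#\{1\le j<T:\ \mu_j(a)\ne\mu_{j+1}(a)\text{ for some }a\}$$ be the number of stationary segments, and let $1=T_0<T_1<\dots<T_L=T+1$ be the change points, so that the means are constant on each segment $\{T_\ell,\dots,T_{\ell+1}-1\}$. Put $\mu_{a,\ell}:=\mu_{T_\ell}(a)$ and $\mu^*_\ell:=\max_a\mu_{a,\ell}$. For a threshold $S\in\mathbb R$ put $\Delta_{a,\ell}:=(S-\mu_{a,\ell})_+$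 and $\Delta^*_\ell:=\mu^*_\ell-S$. The satisficing regret of a policy is $R_T^S:=\mathbb E\big[\sum_{t=1}^T(S-\mu_t(a_t))_+\big]$. **Algorithm (Nonstationary–Sat).** For $w\ge 1$ let $\beta(w):=\sqrt{2(4\log T+\log K)/w}$. For a nonempty buffer $\mathcal B$ (a finite list of rewards) of length $m$, let $w$ range over the powers of two $1,2,4,\dots$ that are at most $m$, let $\mathrm{Avg}(\mathcal B,w)$ be the average of the last $w$ entries, and put $$\mathrm{LCB}(\mathcal B):=\max_w\{\mathrm{Avg}(\mathcal B,w)-\beta(w)\},\qquad \mathrm{UCB}(\mathcal B):=\min_w\{\mathrm{Avg}(\mathcal B,w)+\beta(w)\}.$$ Every arm $a$ has a buffer $\mathcal B_a$, initially empty, and initially there is no leader. In each round $t=1,\dots,T$: - If there is no leader, pull the next arm $a_t$ in a fixed cyclic (round-robin) order of $[K]$ and append $r_t$ to $\mathcal B_{a_t}$. If then $\mathrm{LCB}(\mathcal B_{a_t})\ge S$, make $a_t$ the leader and empty $\mathcal B_{a_t}$. - If there is a leader, pull it as $a_t$ and append $r_t$ to $\mathcal B_{a_t}$. If then $\mathrm{UCB}(\mathcal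 B_{a_t})<S$, empty $\mathcal B_{a_t}$ and continue without a leader. The position in the round-robin order is kept while there is a leader. **Theorem.** For every constant $c$ there is a constant $C>0$, depending only on $c$, such that the following holds for all $K$, $T$, $S$, $(\mu_t)$ and $(\xi_t)$ as above and every round-robin order. If the problem is realizable, i.e. $\mu^*_\ell>S$ for every $\ell\in\{0,\dots,L-1\}$, then the satisficing regret of Nonstationary–Sat satisfies $$R_T^S\ \le\ C\sum_{\ell=0}^{L-1}\ \sum_{a:\ \mu_{a,\ell}<S}\Big(\frac1{\Delta_{a,\ell}}+\frac{\Delta_{a,\ell}}{(\Delta^*_\ell)^2}\Big)\log T .$$ -/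

import Mathlib

open MeasureTheory ProbabilityTheory

noncomputable section

namespace SatBandit

/-! ### The environment

Rounds are numbered `1, …, T`, the arms are the elements of `Fin K`, and `μ t a` is the mean reward
of arm `a` in round `t`. -/

/-- The number `L[s,t]` of stationary segments on the rounds `s, …, t`. -/
def numSegmentsOn {K : ℕ} (μ : ℕ → Fin K → ℝ) (s t : ℕ) : ℕ :=
  1 + ((Finset.Ico s t).filter (fun j => ∃ a, μ j a ≠ μ (j + 1) a)).card

/-- The total number `L = L[1,T]` of stationary segments. -/
def numSegments {K : ℕ} (μ : ℕ → Fin K → ℝ) (T : ℕ) : ℕ := numSegmentsOn μ 1 T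

/-- `t` is the first round of a stationary segment, or is `T + 1`. -/
def IsChangePoint {K : ℕ} (μ : ℕ → Fin K → ℝ) (T t : ℕ) : Prop :=
  t = 1 ∨ t = T + 1 ∨ (2 ≤ t ∧ t ≤ T ∧ ∃ a, μ (t - 1) a ≠ μ t a)

/-- The change points `1 = T_0 < T_1 < ⋯ < T_L = T + 1`, in increasing order; segment `l < L`
consists of the rounds `T_l, …, T_{l+1} - 1`. -/
def changePoint {K : ℕ} (μ : ℕ → Fin K → ℝ) (T l : ℕ) : ℕ := Nat.nth (IsChangePoint μ T) l

/-- The mean `μ_{a,l}` of arm `a` on segment `l`. -/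
def segMean {K : ℕ} (μ : ℕ → Fin K → ℝ) (T l : ℕ) (a : Fin K) : ℝ := μ (changePoint μ T l) a

/-- The largest mean `μ*_l` on segment `l`. -/
def bestMean {K : ℕ} (μ : ℕ → Fin K → ℝ) (T l : ℕ) : ℝ := ⨆ a, segMean μ T l a

/-- `Δ_{a,l} = (S - μ_{a,l})₊`. -/
def gap {K : ℕ} (S : ℝ) (μ : ℕ → Fin K → ℝ) (T l : ℕ) (a : Fin K) : ℝ :=
  max 0 (S - segMean μ T l a)

/-- `Δ*_l = μ*_l - S`. -/
def bestGap {K : ℕ} (S : ℝ) (μ : ℕ → Fin K → ℝ) (T l : ℕ) : ℝ := bestMean μ T l - S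

/-- Realizability: on every segment some arm has mean strictly above the threshold. -/
def Realizable {K : ℕ} (S : ℝ) (μ : ℕ → Fin K → ℝ) (T : ℕ) : Prop :=
  ∀ l < numSegments μ T, S < bestMean μ T l

/-- The noise: `ξ t ω a` is added to the mean if arm `a` is pulled in round `t`. The noise vectors
of different rounds are independent, and each entry is zero-mean and `1`-sub-Gaussian. Nothing is
assumed about the entries of one vector; noise that does not depend on the arm is the case
`ξ t ω a = ξ' t ω`. -/
structure IsNoise {K : ℕ} {Ω : Type*} [MeasurableSpace Ω] (P : Measure Ω)
    (ξ : ℕ → Ω → Fin K → ℝ) : Prop where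
  measurable : ∀ t, Measurable (ξ t)
  indep : iIndepFun ξ P
  mean_zero : ∀ t a, ∫ ω, ξ t ω a ∂P = 0
  subGaussian : ∀ t a, HasSubgaussianMGF (fun ω => ξ t ω a) 1 P

/-! ### Interaction of a policy with the environment -/

/-- A non-randomized policy chooses the next arm from the past (arm, reward) pairs, listed from the
first round to the last. -/
abbrev Policy (K : ℕ) : Type := List (Fin K × ℝ) → Fin K

/-- The history `(a_1, r_1), …, (a_t, r_t)` of the first `t` rounds, where
`r_t = μ t a_t + ξ t a_t`. -/
def history {K : ℕ} {Ω : Type*} (π : Policy K) (μ : ℕ → Fin K → ℝ) (ξ : ℕ → Ω → Fin K → ℝ)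
    (ω : Ω) : ℕ → List (Fin K × ℝ)
  | 0 => []
  | t + 1 =>
    let h := history π μ ξ ω t
    h ++ [(π h, μ (t + 1) (π h) + ξ (t + 1) ω (π h))]

/-- The arm `a_t` pulled in round `t ≥ 1`. -/
def action {K : ℕ} {Ω : Type*} (π : Policy K) (μ : ℕ → Fin K → ℝ) (ξ : ℕ → Ω → Fin K → ℝ)
    (t : ℕ) (ω : Ω) : Fin K :=
  π (history π μ ξ ω (t - 1))

/-- The realized cumulative shortfall `∑_{t=1}^T (S - μ_t(a_t))₊`. -/
def shortfall {K : ℕ} {Ω : Type*} (S : ℝ) (T : ℕ) (π : Policy K) (μ : ℕ → Fin K → ℝ)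
    (ξ : ℕ → Ω → Fin K → ℝ) (ω : Ω) : ℝ :=
  ∑ t ∈ Finset.Icc 1 T, max 0 (S - μ t (action π μ ξ t ω))

/-- The satisficing regret. -/
def regret {K : ℕ} {Ω : Type*} [MeasurableSpace Ω] (P : Measure Ω) (S : ℝ) (T : ℕ)
    (π : Policy K) (μ : ℕ → Fin K → ℝ) (ξ : ℕ → Ω → Fin K → ℝ) : ℝ :=
  ∫ ω, shortfall S T π μ ξ ω ∂P

/-! ### Windowed statistics; buffers are listed from the oldest entry to the newest -/

/-- The dyadic window lengths `2 ^ k ≤ m`, for a buffer of length `m` (`k < m` is automatic). -/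
def winSet (m : ℕ) : Finset ℕ :=
  ((Finset.range m).image (fun k => 2 ^ k)).filter (fun w => w ≤ m)

/-- The average of the last `w` entries of a buffer. -/
def avgLast (B : List ℝ) (w : ℕ) : ℝ := (B.drop (B.length - w)).sum / w

/-- The windowed lower confidence bound: a maximum over all windows (`⊥` for an empty buffer). -/
def lcbWin (β : ℕ → ℝ) (B : List ℝ) : EReal :=
  (winSet B.length).sup (fun w => ((avgLast B w - β w : ℝ) : EReal))

/-- The windowed upper confidence bound: a minimum over all windows (`⊤` for an empty buffer). -/
def ucbWin (β : ℕ → ℝ) (B : List ℝ) : EReal :=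
  (winSet B.length).inf (fun w => ((avgLast B w + β w : ℝ) : EReal))

/-- The confidence radius `β(w) = √(2 (4 log T + log K) / w)`. -/
def radius (K T : ℕ) (w : ℕ) : ℝ :=
  Real.sqrt (2 * (4 * Real.log T + Real.log K) / w)

/-! ### The algorithm Nonstationary–Sat -/

/-- The state of the algorithm: the leader, the buffer of the current epoch of each arm (buffers of
past epochs are never read again, so they are not kept), and the number of round-robin pulls made
so far. -/
structure State (K : ℕ) where
  leader : Option (Fin K)
  buffer : Fin K → List ℝ
  explored : ℕ

/-- Initially there is no leader and all buffers are empty. -/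
def State.init (K : ℕ) : State K := ⟨none, fun _ => [], 0⟩

/-- The arm pulled next: the leader, or, if there is none, the next arm in the fixed round-robin
order `order 0, order 1, …, order (K - 1), order 0, …`. -/
def State.arm {K : ℕ} [NeZero K] (order : Equiv.Perm (Fin K)) (st : State K) : Fin K :=
  match st.leader with
  | none => order (Fin.ofNat K st.explored)
  | some a => a

/-- One round: the new reward `r` is appended to the buffer `B` of the pulled arm. While exploring,
the arm is promoted if `LCB(B) ≥ S`; otherwise the leader is demoted if `UCB(B) < S`. Promotion and
demotion start a new epoch of the arm, with an empty buffer. -/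
def State.step {K : ℕ} [NeZero K] (S : ℝ) (β : ℕ → ℝ) (order : Equiv.Perm (Fin K))
    (st : State K) (r : ℝ) : State K :=
  let a := st.arm order
  let B := st.buffer a ++ [r]
  open Classical in
  match st.leader with
  | none =>
    if (S : EReal) ≤ lcbWin β B then
      ⟨some a, Function.update st.buffer a [], st.explored + 1⟩
    else
      ⟨none, Function.update st.buffer a B, st.explored + 1⟩
  | some _ =>
    if ucbWin β B < (S : EReal) then
      ⟨none, Function.update st.buffer a [], st.explored⟩
    else
      ⟨some a, Function.update st.buffer a B, st.explored⟩

/-- The policy Nonstationary–Sat for horizon `T` and threshold `S`. -/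
def nonstationarySat (K T : ℕ) [NeZero K] (S : ℝ) (order : Equiv.Perm (Fin K)) : Policy K :=
  fun h => State.arm order
    (h.foldl (fun st p => State.step S (radius K T) order st p.2) (State.init K))

end SatBandit

end

/-! On the good event every windowed average of the rewards of an arm on a stationary segment is
within the confidence radius of its mean. An arm is in the wrong status if its mean is below `S` and
it leads, or its mean is at least `S` and it does not lead. An arm never re-enters the wrong status
with a buffer that started in the segment, so the pulls in the wrong status belong to a single epoch
of its buffer, which a power-of-two window ends after `O(log T / δ ^ 2)` pulls, where `δ` is the
distance of the mean from `S`. This bounds the pulls of a bad arm as a leader by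
`O(log T / Δ_a ^ 2)` and the exploration pulls of a good arm by `O(log T / Δ* ^ 2)`; by round robin
the exploration pulls of the bad arm exceed those of the good arm by at most one. Multiplying by
`Δ_a` gives the regret on a segment.

The good event concerns the noise over the pulls of an arm in an interval of rounds. The rounds are
chosen adaptively, but whether an arm is pulled is known before the noise is drawn, so the
exponential moments of the noise over its pulls are at most those of independent noise. A union
bound over arms, intervals and numbers of pulls leaves a failure probability of `2 / T`, and the
regret is at most `T` times the sum in the bound in any case.
-/

namespace SatBandit

/-! ### Windowed statistics -/

theorem mem_winSet {m w : ℕ} : w ∈ winSet m ↔ (∃ k, 2 ^ k = w) ∧ w ≤ m := by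
  simp only [winSet, Finset.mem_filter, Finset.mem_image, Finset.mem_range]
  constructor
  · rintro ⟨⟨k, -, rfl⟩, h⟩
    exact ⟨⟨k, rfl⟩, h⟩
  · rintro ⟨⟨k, rfl⟩, h⟩
    exact ⟨⟨k, Nat.lt_two_pow_self.trans_le h, rfl⟩, h⟩

theorem one_le_of_mem_winSet {m w : ℕ} (h : w ∈ winSet m) : 1 ≤ w := by
  obtain ⟨⟨k, rfl⟩, -⟩ := mem_winSet.1 h
  exact Nat.one_le_two_pow

theorem winSet_mono {m n : ℕ} (h : m ≤ n) : winSet m ⊆ winSet n := fun _ hw =>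
  mem_winSet.2 ⟨(mem_winSet.1 hw).1, (mem_winSet.1 hw).2.trans h⟩

theorem exists_mem_winSet_le_two_mul {m : ℕ} (hm : m ≠ 0) : ∃ w ∈ winSet m, m ≤ 2 * w := by
  refine ⟨2 ^ Nat.log 2 m, mem_winSet.2 ⟨⟨_, rfl⟩, Nat.pow_log_le_self 2 hm⟩, ?_⟩
  rw [← pow_succ']
  exact (Nat.lt_pow_succ_log_self one_lt_two m).le

theorem le_lcbWin_iff {β : ℕ → ℝ} {B : List ℝ} {S : ℝ} :
    (S : EReal) ≤ lcbWin β B ↔ ∃ w ∈ winSet B.length, S ≤ avgLast B w - β w := by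
  rw [lcbWin, Finset.le_sup_iff (EReal.bot_lt_coe S)]
  simp only [EReal.coe_le_coe_iff]

theorem ucbWin_lt_iff {β : ℕ → ℝ} {B : List ℝ} {S : ℝ} :
    ucbWin β B < (S : EReal) ↔ ∃ w ∈ winSet B.length, avgLast B w + β w < S := by
  rw [ucbWin, Finset.inf_lt_iff]
  simp only [EReal.coe_lt_coe_iff]

theorem avgLast_of_suffix {L B : List ℝ} (h : L <:+ B) {w : ℕ} (hw : w ≤ L.length) :
    avgLast B w = avgLast L w := by
  obtain ⟨A, rfl⟩ := h
  rw [avgLast, avgLast, List.length_append, Nat.add_sub_assoc hw, List.drop_length_add_append]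

/-- The good event for one buffer `L`: the average over every window at the end of `L` lies within
the confidence radius of `m`. -/
def AccurateWindows (β : ℕ → ℝ) (m : ℝ) (L : List ℝ) : Prop :=
  ∀ w, 1 ≤ w → w ≤ L.length → |avgLast L w - m| ≤ β w

section AccurateWindows

variable {β : ℕ → ℝ} {m S : ℝ} {L B : List ℝ}

theorem AccurateWindows.abs_sub_le (h : AccurateWindows β m L) {w : ℕ}
    (hw : w ∈ winSet L.length) : |avgLast L w - m| ≤ β w :=
  h w (one_le_of_mem_winSet hw) (mem_winSet.1 hw).2

theorem AccurateWindows.not_le_lcbWin (h : AccurateWindows β m L) (hm : m < S) :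
    ¬(S : EReal) ≤ lcbWin β L := by
  rw [le_lcbWin_iff]
  rintro ⟨w, hw, hS⟩
  linarith [(abs_le.1 (h.abs_sub_le hw)).2]

theorem AccurateWindows.not_ucbWin_lt (h : AccurateWindows β m L) (hm : S ≤ m) :
    ¬ucbWin β L < (S : EReal) := by
  rw [ucbWin_lt_iff]
  rintro ⟨w, hw, hS⟩
  linarith [(abs_le.1 (h.abs_sub_le hw)).1]

theorem exists_window_of_suffix (hL : L <:+ B) (h0 : L.length ≠ 0) :
    ∃ w ∈ winSet L.length, w ∈ winSet B.length ∧ avgLast B w = avgLast L w ∧ L.length ≤ 2 * w := by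
  obtain ⟨w, hw, hw2⟩ := exists_mem_winSet_le_two_mul h0
  exact ⟨w, hw, winSet_mono hL.length_le hw, avgLast_of_suffix hL (mem_winSet.1 hw).2, hw2⟩

variable {N : ℕ}

theorem AccurateWindows.length_le_of_not_ucbWin_lt (h : AccurateWindows β m L)
    (hN : ∀ w, 1 ≤ w → S - m ≤ 2 * β w → 2 * w ≤ N) (hL : L <:+ B)
    (hB : ¬ucbWin β B < (S : EReal)) : L.length ≤ N := by
  rcases eq_or_ne L.length 0 with h0 | h0
  · exact h0.trans_le N.zero_le
  obtain ⟨w, hwL, hwB, havg, hw2⟩ := exists_window_of_suffix hL h0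
  have hS : S ≤ avgLast B w + β w :=
    not_lt.1 fun hlt => hB (ucbWin_lt_iff.2 ⟨w, hwB, hlt⟩)
  refine hw2.trans (hN w (one_le_of_mem_winSet hwL) ?_)
  linarith [(abs_le.1 (h.abs_sub_le hwL)).2]

theorem AccurateWindows.length_le_of_not_le_lcbWin (h : AccurateWindows β m L)
    (hN : ∀ w, 1 ≤ w → m - S ≤ 2 * β w → 2 * w ≤ N) (hL : L <:+ B)
    (hB : ¬(S : EReal) ≤ lcbWin β B) : L.length ≤ N := by
  rcases eq_or_ne L.length 0 with h0 | h0
  · exact h0.trans_le N.zero_le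
  obtain ⟨w, hwL, hwB, havg, hw2⟩ := exists_window_of_suffix hL h0
  have hS : avgLast B w - β w < S :=
    not_le.1 fun hle => hB (le_lcbWin_iff.2 ⟨w, hwB, hle⟩)
  refine hw2.trans (hN w (one_le_of_mem_winSet hwL) ?_)
  linarith [(abs_le.1 (h.abs_sub_le hwL)).1]

end AccurateWindows

/-- The logarithmic factor in the confidence radius: `radius K T w ^ 2 = 2 * logFactor K T / w`. -/
noncomputable def logFactor (K T : ℕ) : ℝ := 4 * Real.log T + Real.log K

theorem logFactor_nonneg (K T : ℕ) : 0 ≤ logFactor K T :=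
  add_nonneg (mul_nonneg zero_le_four (Real.log_natCast_nonneg T)) (Real.log_natCast_nonneg K)

theorem radius_sq (K T w : ℕ) : radius K T w ^ 2 = 2 * logFactor K T / w :=
  Real.sq_sqrt (div_nonneg (mul_nonneg zero_le_two (logFactor_nonneg K T)) w.cast_nonneg)

theorem two_mul_le_floor_of_le_two_mul_radius {K T : ℕ} {δ : ℝ} (hδ : 0 < δ) {w : ℕ} (hw : 1 ≤ w)
    (h : δ ≤ 2 * radius K T w) : 2 * w ≤ ⌊16 * logFactor K T / δ ^ 2⌋₊ := by
  have hw0 : (0 : ℝ) < w := by exact_mod_cast hw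
  have hsq : δ ^ 2 ≤ 8 * logFactor K T / w :=
    calc δ ^ 2 ≤ (2 * radius K T w) ^ 2 := pow_le_pow_left₀ hδ.le h 2
      _ = 8 * logFactor K T / w := by rw [mul_pow, radius_sq]; ring
  rw [le_div_iff₀ hw0] at hsq
  refine Nat.le_floor ?_
  rw [le_div_iff₀ (pow_pos hδ 2)]
  push_cast
  linarith

/-! ### The rounds in which an arm is pulled -/

section Pulls

variable {ι : Type*} [DecidableEq ι] (α : ℕ → ι) (a : ι)

/-- The rounds `τ ∈ [u, t)` in which the sequence of actions `α` takes the value `a`, in increasing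
order. -/
def pulls (u t : ℕ) : List ℕ := (List.Ico u t).filter (α · = a)

theorem pulls_self (t : ℕ) : pulls α a t t = [] := by
  rw [pulls, List.Ico.self_empty, List.filter_nil]

variable {α a}

theorem pulls_succ_of_eq {u t : ℕ} (hut : u ≤ t) (ha : α t = a) :
    pulls α a u (t + 1) = pulls α a u t ++ [t] := by
  simp [pulls, List.Ico.succ_top hut, ha]

theorem pulls_succ_of_ne {u t : ℕ} (hut : u ≤ t) (ha : α t ≠ a) :
    pulls α a u (t + 1) = pulls α a u t := by
  simp [pulls, List.Ico.succ_top hut, ha]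

variable (α a)

theorem sum_map_pulls (f : ℕ → ℝ) (u t : ℕ) :
    ((pulls α a u t).map f).sum = ∑ τ ∈ Finset.Ico u t with α τ = a, f τ := rfl

theorem length_pulls (u t : ℕ) :
    (pulls α a u t).length = ((Finset.Ico u t).filter (α · = a)).card := rfl

theorem exists_pulls_of_suffix {u t : ℕ} {L : List ℕ} (h : L <:+ pulls α a u t) :
    ∃ v, u ≤ v ∧ L = pulls α a v t := by
  obtain ⟨L', hL', rfl⟩ := List.suffix_filter_iff.1 h
  obtain ⟨j, rfl⟩ : ∃ j, L' = (List.Ico u t).drop j := ⟨_, List.suffix_iff_eq_drop.1 hL'⟩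
  refine ⟨u + j, Nat.le_add_right u j, ?_⟩
  rw [pulls, List.Ico, List.Ico, List.drop_range', mul_one, Nat.sub_sub]

end Pulls

section Concentration

variable {ι : Type*} [DecidableEq ι]

/-- The good event: for every arm and every interval of rounds below `T`, the noise of the `n`
pulls of the arm in the interval has average at most `β n`. -/
def Concentrated (β : ℕ → ℝ) (α : ℕ → ι) (z : ℕ → ι → ℝ) (T : ℕ) : Prop :=
  ∀ a u t, t ≤ T → |∑ τ ∈ Finset.Ico u t with α τ = a, z τ a| ≤
    ((Finset.Ico u t).filter (α · = a)).card * β ((Finset.Ico u t).filter (α · = a)).card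

/-- The good event on the rounds `[s, e)` of a stationary segment with means `m`: the windowed
averages of the rewards `y` of every arm are accurate, for buffers started anywhere in `[s, e)`. -/
def Accurate (β : ℕ → ℝ) (m : ι → ℝ) (y : ℕ → ι → ℝ) (α : ℕ → ι) (s e : ℕ) : Prop :=
  ∀ a u t, s ≤ u → t ≤ e → AccurateWindows β (m a) ((pulls α a u t).map (y · a))

theorem Concentrated.accurate {β : ℕ → ℝ} {α : ℕ → ι} {z y : ℕ → ι → ℝ} {T : ℕ}
    (hz : Concentrated β α z T) {m : ι → ℝ} {s e : ℕ} (he : e ≤ T)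
    (hy : ∀ τ, s ≤ τ → τ < e → ∀ a, y τ a = m a + z τ a) : Accurate β m y α s e := by
  intro a u t hu ht w hw hwlen
  rw [List.length_map] at hwlen
  obtain ⟨v, huv, hv⟩ := exists_pulls_of_suffix α a
    (List.drop_suffix ((pulls α a u t).length - w) (pulls α a u t))
  have hlen : ((Finset.Ico v t).filter (α · = a)).card = w := by
    rw [← length_pulls, ← hv, List.length_drop]
    omega
  have hw0 : (0 : ℝ) < w := by exact_mod_cast hw
  have hsum : avgLast ((pulls α a u t).map (y · a)) w - m a =
      (∑ τ ∈ Finset.Ico v t with α τ = a, z τ a) / w := by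
    have hy' : ∑ τ ∈ Finset.Ico v t with α τ = a, y τ a =
        ∑ τ ∈ Finset.Ico v t with α τ = a, (m a + z τ a) := by
      refine Finset.sum_congr rfl fun τ hτ => hy τ ?_ ?_ a <;>
        simp only [Finset.mem_filter, Finset.mem_Ico] at hτ <;> omega
    rw [avgLast, List.length_map, ← List.map_drop, hv, sum_map_pulls, hy', Finset.sum_add_distrib,
      Finset.sum_const, hlen, nsmul_eq_mul]
    field_simp
    ring
  rw [hsum, abs_div, Nat.abs_cast, div_le_iff₀ hw0, mul_comm]
  simpa only [hlen] using hz a v t (ht.trans he)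

end Concentration

/-! ### The run of the algorithm on a table of rewards -/

/-- A state of the algorithm in which the buffers hold the rounds of the pulls instead of the
rewards, so that there are only countably many states. -/
@[ext]
structure Trace (K : ℕ) where
  leader : Option (Fin K)
  buffer : Fin K → List ℕ
  explored : ℕ

/-- The state of the algorithm behind a trace, for the table of rewards `y`. -/
def Trace.realize {K : ℕ} (y : ℕ → Fin K → ℝ) (x : Trace K) : State K :=
  ⟨x.leader, fun a => (x.buffer a).map (y · a), x.explored⟩

section Run

variable {K : ℕ} [NeZero K] (S : ℝ) (β : ℕ → ℝ) (order : Equiv.Perm (Fin K))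
  (y : ℕ → Fin K → ℝ) (t : ℕ) (x : Trace K)

/-- The arm pulled next. -/
def Trace.arm : Fin K :=
  match x.leader with
  | none => order (Fin.ofNat K x.explored)
  | some a => a

/-- The arm pulled in round `t` changes its status, by promotion or by demotion. -/
def Trace.Switches : Prop :=
  if x.leader = none then
    (S : EReal) ≤ lcbWin β ((x.buffer (x.arm order) ++ [t]).map (y · (x.arm order)))
  else ucbWin β ((x.buffer (x.arm order) ++ [t]).map (y · (x.arm order))) < (S : EReal)

open Classical in
/-- Round `t` on the table of rewards `y`. -/
noncomputable def Trace.step : Trace K where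
  leader :=
    if x.Switches S β order y t then
      if x.leader = none then some (x.arm order) else none
    else x.leader
  buffer := Function.update x.buffer (x.arm order)
    (if x.Switches S β order y t then [] else x.buffer (x.arm order) ++ [t])
  explored := x.explored + if x.leader = none then 1 else 0

/-- The trace before round `t` on the table of rewards `y`, where the rounds are numbered from
`0`. -/
noncomputable def run : ℕ → Trace K
  | 0 => ⟨none, fun _ => [], 0⟩
  | t + 1 => (run t).step S β order y t

/-- The arm pulled in round `t` on the table of rewards `y`. -/
noncomputable def runArm (t : ℕ) : Fin K := (run S β order y t).arm order

omit [NeZero K] in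
theorem map_update_buffer (f : Fin K → List ℕ) (a : Fin K) (B : List ℕ) :
    (fun b => (Function.update f a B b).map (y · b)) =
      Function.update (fun b => (f b).map (y · b)) a (B.map (y · a)) :=
  funext fun b => Function.apply_update (fun b L => List.map (y · b) L) f a B b

theorem Trace.realize_step :
    (x.step S β order y t).realize y =
      (x.realize y).step S β order (y t (x.arm order)) := by
  obtain ⟨_ | a, f, n⟩ := x <;>
    simp only [Trace.realize, Trace.step, State.step, map_update_buffer, apply_ite (List.map _)] <;>
    split_ifs <;> simp_all [-not_le, -not_lt, Trace.Switches, State.arm, Trace.arm]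

theorem foldl_history {Ω : Type*} (T : ℕ) (μ : ℕ → Fin K → ℝ) (ξ : ℕ → Ω → Fin K → ℝ) (ω : Ω) :
    (history (nonstationarySat K T S order) μ ξ ω t).foldl
        (fun st p => State.step S (radius K T) order st p.2) (State.init K) =
      (run S (radius K T) order (fun τ a => μ (τ + 1) a + ξ (τ + 1) ω a) t).realize
        (fun τ a => μ (τ + 1) a + ξ (τ + 1) ω a) := by
  induction t with
  | zero => rfl
  | succ t ih =>
    have harm : nonstationarySat K T S order (history (nonstationarySat K T S order) μ ξ ω t) =
        runArm S (radius K T) order (fun τ a => μ (τ + 1) a + ξ (τ + 1) ω a) t :=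
      congrArg (State.arm order) ih
    rw [history, List.foldl_append, ih, run, Trace.realize_step, List.foldl_cons, List.foldl_nil,
      harm, runArm]

theorem action_succ {Ω : Type*} (T : ℕ) (μ : ℕ → Fin K → ℝ) (ξ : ℕ → Ω → Fin K → ℝ) (ω : Ω) :
    action (nonstationarySat K T S order) μ ξ (t + 1) ω =
      runArm S (radius K T) order (fun τ a => μ (τ + 1) a + ξ (τ + 1) ω a) t :=
  congrArg (State.arm order) (foldl_history S order t T μ ξ ω)

end Run

section Step

variable {K : ℕ} [NeZero K] {S : ℝ} {β : ℕ → ℝ} {order : Equiv.Perm (Fin K)}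
  {y : ℕ → Fin K → ℝ} {t : ℕ} {x : Trace K} {a : Fin K}

theorem Trace.arm_of_leader (h : x.leader = some a) : x.arm order = a := by
  simp only [Trace.arm, h]

theorem Trace.leader_eq_none (ha : x.arm order = a) (h : x.leader ≠ some a) : x.leader = none :=
  Option.eq_none_iff_forall_ne_some.2 fun b hb =>
    h (by rw [hb, ← ha, Trace.arm_of_leader hb])

theorem Trace.buffer_step_of_ne (ha : x.arm order ≠ a) :
    (x.step S β order y t).buffer a = x.buffer a :=
  Function.update_of_ne ha.symm _ _

theorem Trace.leader_step_of_ne (ha : x.arm order ≠ a) :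
    (x.step S β order y t).leader = some a ↔ x.leader = some a := by
  have hx : x.leader ≠ some a := fun h => ha (Trace.arm_of_leader h)
  simp only [Trace.step]
  split_ifs <;> simp [ha, hx]

theorem Trace.buffer_step_of_switches (ha : x.arm order = a) (h : x.Switches S β order y t) :
    (x.step S β order y t).buffer a = [] := by
  simp only [Trace.step, ha, h, if_true, Function.update_self]

theorem Trace.buffer_step_of_not_switches (ha : x.arm order = a)
    (h : ¬x.Switches S β order y t) :
    (x.step S β order y t).buffer a = x.buffer a ++ [t] := by
  simp only [Trace.step, ha, h, if_false, Function.update_self]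

theorem Trace.leader_step_of_switches (ha : x.arm order = a) (h : x.Switches S β order y t) :
    (x.step S β order y t).leader = some a ↔ x.leader ≠ some a := by
  simp only [Trace.step, h, if_true, ha]
  by_cases hx : x.leader = some a
  · simp [hx]
  · simp [Trace.leader_eq_none ha hx]

theorem Trace.leader_step_of_not_switches (h : ¬x.Switches S β order y t) :
    (x.step S β order y t).leader = x.leader := by
  simp only [Trace.step, h, if_false]

theorem Trace.switches_iff_of_leader (h : x.leader = some a) :
    x.Switches S β order y t ↔
      ucbWin β ((x.buffer a ++ [t]).map (y · a)) < (S : EReal) := by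
  simp only [Trace.Switches, h, reduceCtorEq, if_false, Trace.arm_of_leader h]

theorem Trace.switches_iff_of_explores (ha : x.arm order = a) (h : x.leader ≠ some a) :
    x.Switches S β order y t ↔
      (S : EReal) ≤ lcbWin β ((x.buffer a ++ [t]).map (y · a)) := by
  simp only [Trace.Switches, Trace.leader_eq_none ha h, if_true, ha]

end Step

/-! ### The number of pulls in the wrong status on a stationary segment -/

/-- The evolution of one arm: `α` is the sequence of pulled arms, `q t` says whether the arm has a
given status before round `t`, and `B t` is its buffer. A pull of the arm either appends the round
to the buffer, or changes the status and empties the buffer. -/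
structure IsEpochs {ι : Type*} (α : ℕ → ι) (a : ι) (q : ℕ → Prop) (B : ℕ → List ℕ) : Prop where
  status_of_ne : ∀ t, α t ≠ a → (q (t + 1) ↔ q t)
  buffer_of_ne : ∀ t, α t ≠ a → B (t + 1) = B t
  switch_or_append : ∀ t, α t = a →
    (q (t + 1) ↔ ¬q t) ∧ B (t + 1) = [] ∨ (q (t + 1) ↔ q t) ∧ B (t + 1) = B t ++ [t]

section Epochs

variable {ι : Type*} [DecidableEq ι] {α : ℕ → ι} {a : ι} {q : ℕ → Prop} {B : ℕ → List ℕ}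
  {s e N : ℕ}

open Classical in
/-- The number of pulls of the arm `a` in the rounds `[s, t)` in which it has the status `q`. -/
noncomputable def statusPulls (α : ℕ → ι) (a : ι) (q : ℕ → Prop) (s t : ℕ) : ℕ :=
  ((Finset.Ico s t).filter (fun τ => α τ = a ∧ q τ)).card

theorem statusPulls_self (t : ℕ) : statusPulls α a q t t = 0 := by
  simp [statusPulls]

theorem statusPulls_succ_of_pos {t : ℕ} (hst : s ≤ t) (ha : α t = a) (hq : q t) :
    statusPulls α a q s (t + 1) = statusPulls α a q s t + 1 := by
  rw [statusPulls, statusPulls, Nat.Ico_succ_right_eq_insert_Ico hst, Finset.filter_insert,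
    if_pos ⟨ha, hq⟩, Finset.card_insert_of_notMem (by simp)]

theorem statusPulls_succ_of_neg {t : ℕ} (hst : s ≤ t) (h : ¬(α t = a ∧ q t)) :
    statusPulls α a q s (t + 1) = statusPulls α a q s t := by
  rw [statusPulls, statusPulls, Nat.Ico_succ_right_eq_insert_Ico hst, Finset.filter_insert,
    if_neg h]

theorem statusPulls_add_statusPulls_not (α : ℕ → ι) (a : ι) (q : ℕ → Prop) (s t : ℕ) :
    statusPulls α a q s t + statusPulls α a (fun τ => ¬q τ) s t =
      ((Finset.Ico s t).filter (α · = a)).card := by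
  classical
  simp only [statusPulls, ← Finset.filter_filter]
  convert Finset.card_filter_add_card_filter_not (s := (Finset.Ico s t).filter (α · = a)) q

/-- The possible situations of an arm before round `t`, counted from round `s`, when `q` is the
wrong status: the wrong status has not occurred yet, or it holds and the buffer contains all wrong
pulls, or it has been left after at most `N + 1` wrong pulls and the buffer is fresh. -/
inductive Phase (α : ℕ → ι) (a : ι) (q : ℕ → Prop) (B : ℕ → List ℕ) (s N t : ℕ) : Prop
  | before : ¬q t → statusPulls α a q s t = 0 → Phase α a q B s N t
  | during (u : ℕ) : q t → s ≤ u → u ≤ t → pulls α a u t <:+ B t → (pulls α a u t).length ≤ N →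
      statusPulls α a q s t = (pulls α a u t).length → Phase α a q B s N t
  | after (u : ℕ) : ¬q t → s ≤ u → u ≤ t → B t = pulls α a u t →
      statusPulls α a q s t ≤ N + 1 → Phase α a q B s N t

omit [DecidableEq ι] in
theorem IsEpochs.not (h : IsEpochs α a q B) : IsEpochs α a (fun t => ¬q t) B where
  status_of_ne t ha := not_congr (h.status_of_ne t ha)
  buffer_of_ne := h.buffer_of_ne
  switch_or_append t ha :=
    (h.switch_or_append t ha).imp (And.imp_left not_congr) (And.imp_left not_congr)

theorem IsEpochs.phase_succ_of_ne (h : IsEpochs α a q B) {t : ℕ} (hst : s ≤ t) (ha : α t ≠ a)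
    (hp : Phase α a q B s N t) : Phase α a q B s N (t + 1) := by
  have hcard := statusPulls_succ_of_neg (q := q) hst fun h => ha h.1
  cases hp with
  | before hq hc => exact .before (mt (h.status_of_ne t ha).1 hq) (hcard.trans hc)
  | during u hq hsu hut hB hlen hc =>
    rw [← pulls_succ_of_ne hut ha] at hB hlen hc
    exact .during u ((h.status_of_ne t ha).2 hq) hsu (hut.trans t.le_succ)
      (h.buffer_of_ne t ha ▸ hB) hlen (hcard.trans hc)
  | after u hq hsu hut hB hc =>
    exact .after u (mt (h.status_of_ne t ha).1 hq) hsu (hut.trans t.le_succ)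
      (by rw [h.buffer_of_ne t ha, hB, pulls_succ_of_ne hut ha]) (hcard.trans_le hc)

theorem IsEpochs.phase_succ_of_eq (h : IsEpochs α a q B) {t : ℕ} (hst : s ≤ t) (ha : α t = a)
    (hexit : ∀ u, s ≤ u → u ≤ t → q t → q (t + 1) → pulls α a u (t + 1) <:+ B t ++ [t] →
      (pulls α a u (t + 1)).length ≤ N)
    (hstay : ∀ u, s ≤ u → u ≤ t → ¬q t → B t ++ [t] = pulls α a u (t + 1) → ¬q (t + 1))
    (hp : Phase α a q B s N t) : Phase α a q B s N (t + 1) := by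
  have hcard (hq : ¬q t) := statusPulls_succ_of_neg hst fun h : α t = a ∧ q t => hq h.2
  have hnil : pulls α a (t + 1) (t + 1) = [] := pulls_self α a (t + 1)
  cases hp with
  | before hq hc =>
    rcases h.switch_or_append t ha with ⟨hq', -⟩ | ⟨hq', -⟩
    · exact .during (t + 1) (hq'.2 hq) (by omega) le_rfl (hnil ▸ List.nil_suffix)
        (by simp [hnil]) (by rw [hcard hq, hc, hnil, List.length_nil])
    · exact .before (mt hq'.1 hq) ((hcard hq).trans hc)
  | during u hq hsu hut hB hlen hc =>
    have hpull := pulls_succ_of_eq hut ha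
    have hcount := statusPulls_succ_of_pos hst ha hq
    rcases h.switch_or_append t ha with ⟨hq', hB'⟩ | ⟨hq', hB'⟩
    · exact .after (t + 1) (fun hq1 => hq'.1 hq1 hq) (by omega) le_rfl (hB'.trans hnil.symm)
        (by omega)
    · have hsuf : pulls α a u (t + 1) <:+ B t ++ [t] := by
        rw [hpull]
        exact List.suffix_concat_iff.2 (.inr ⟨_, rfl, hB⟩)
      exact .during u (hq'.2 hq) hsu (by omega) (hB' ▸ hsuf)
        (hexit u hsu hut hq (hq'.2 hq) hsuf) (by rw [hcount, hc, hpull, List.length_append]; rfl)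
  | after u hq hsu hut hB hc =>
    have hpull : B t ++ [t] = pulls α a u (t + 1) := by rw [hB, pulls_succ_of_eq hut ha]
    have hq1 : ¬q (t + 1) := hstay u hsu hut hq hpull
    rcases h.switch_or_append t ha with ⟨hq', -⟩ | ⟨-, hB'⟩
    · exact absurd (hq'.2 hq) hq1
    · exact .after u hq1 hsu (by omega) (hB'.trans hpull) ((hcard hq).trans_le hc)

theorem IsEpochs.statusPulls_le (h : IsEpochs α a q B) (hse : s ≤ e)
    (hexit : ∀ u t, s ≤ u → u ≤ t → t < e → α t = a → q t → q (t + 1) →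
      pulls α a u (t + 1) <:+ B t ++ [t] → (pulls α a u (t + 1)).length ≤ N)
    (hstay : ∀ u t, s ≤ u → u ≤ t → t < e → α t = a → ¬q t →
      B t ++ [t] = pulls α a u (t + 1) → ¬q (t + 1)) :
    statusPulls α a q s e ≤ N + 1 := by
  have hphase : Phase α a q B s N e := by
    refine Nat.le_induction (m := s) (P := fun t _ => t ≤ e → Phase α a q B s N t) ?_ ?_ e hse
      le_rfl
    · intro _
      have hnil := pulls_self α a s
      by_cases hq : q s
      · exact .during s hq le_rfl le_rfl (hnil ▸ List.nil_suffix) (by simp [hnil])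
          (by rw [statusPulls_self, hnil, List.length_nil])
      · exact .before hq (statusPulls_self s)
    · intro t hst ih hte
      by_cases ha : α t = a
      · exact h.phase_succ_of_eq hst ha (fun u hsu hut => hexit u t hsu hut hte ha)
          (fun u hsu hut => hstay u t hsu hut hte ha) (ih (by omega))
      · exact h.phase_succ_of_ne hst ha (ih (by omega))
  cases hphase <;> omega

end Epochs

section StationarySegment

variable {K : ℕ} [NeZero K] {S : ℝ} {β : ℕ → ℝ} {order : Equiv.Perm (Fin K)}
  {y : ℕ → Fin K → ℝ} {m : Fin K → ℝ} {s e N : ℕ} {a : Fin K}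

theorem isEpochs_run (a : Fin K) :
    IsEpochs (runArm S β order y) a (fun t => (run S β order y t).leader = some a)
      (fun t => (run S β order y t).buffer a) where
  status_of_ne _ ha := Trace.leader_step_of_ne ha
  buffer_of_ne _ ha := Trace.buffer_step_of_ne ha
  switch_or_append t ha := by
    by_cases h : (run S β order y t).Switches S β order y t
    · exact .inl ⟨Trace.leader_step_of_switches ha h, Trace.buffer_step_of_switches ha h⟩
    · exact .inr ⟨by simp only [run, Trace.leader_step_of_not_switches h],
        Trace.buffer_step_of_not_switches ha h⟩

theorem not_switches_of_leader_succ_iff {t : ℕ} (ha : runArm S β order y t = a)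
    (h : (run S β order y (t + 1)).leader = some a ↔ (run S β order y t).leader = some a) :
    ¬(run S β order y t).Switches S β order y t := fun hsw => by
  rw [run, Trace.leader_step_of_switches ha hsw] at h
  tauto

theorem leader_succ_of_not_switches {t : ℕ}
    (h : ¬(run S β order y t).Switches S β order y t) :
    (run S β order y (t + 1)).leader = (run S β order y t).leader :=
  Trace.leader_step_of_not_switches h

theorem leadPulls_le (hacc : Accurate β m y (runArm S β order y) s e) (hse : s ≤ e)
    (hm : m a < S) (hN : ∀ w, 1 ≤ w → S - m a ≤ 2 * β w → 2 * w ≤ N) :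
    statusPulls (runArm S β order y) a (fun t => (run S β order y t).leader = some a) s e ≤
      N + 1 := by
  refine (isEpochs_run a).statusPulls_le hse ?_ ?_
  · intro u t hsu _ hte ha hq hq' hsuf
    have hsw := not_switches_of_leader_succ_iff ha (iff_of_true hq' hq)
    rw [Trace.switches_iff_of_leader hq] at hsw
    simpa using (hacc a u (t + 1) hsu hte).length_le_of_not_ucbWin_lt hN (hsuf.map _) hsw
  · intro u t hsu _ hte ha hq hB
    rw [leader_succ_of_not_switches]
    · exact hq
    rw [Trace.switches_iff_of_explores ha hq, hB]
    exact (hacc a u (t + 1) hsu hte).not_le_lcbWin hm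

theorem explorePulls_le (hacc : Accurate β m y (runArm S β order y) s e) (hse : s ≤ e)
    (hm : S ≤ m a) (hN : ∀ w, 1 ≤ w → m a - S ≤ 2 * β w → 2 * w ≤ N) :
    statusPulls (runArm S β order y) a (fun t => (run S β order y t).leader ≠ some a) s e ≤
      N + 1 := by
  refine (isEpochs_run a).not.statusPulls_le hse ?_ ?_
  · intro u t hsu _ hte ha hq hq' hsuf
    have hsw := not_switches_of_leader_succ_iff ha (iff_of_false hq' hq)
    rw [Trace.switches_iff_of_explores ha hq] at hsw
    simpa using (hacc a u (t + 1) hsu hte).length_le_of_not_le_lcbWin hN (hsuf.map _) hsw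
  · intro u t hsu _ hte _ hq hB
    rw [leader_succ_of_not_switches]
    · exact hq
    rw [Trace.switches_iff_of_leader (not_not.1 hq), hB]
    exact (hacc a u (t + 1) hsu hte).not_ucbWin_lt hm

end StationarySegment

/-! ### Round-robin exploration -/

theorem abs_card_filter_modEq_sub_lt_one {a b r : ℕ} (hab : a ≤ b) (hr : 0 < r) (v : ℕ) :
    |(((Finset.Ico a b).filter (· ≡ v [MOD r])).card : ℚ) - (b - a) / r| < 1 := by
  have hmono : ⌈((a : ℚ) - v) / r⌉ ≤ ⌈((b : ℚ) - v) / r⌉ :=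
    Int.ceil_mono <| div_le_div_of_nonneg_right (sub_le_sub_right (Nat.cast_le.2 hab) _)
      r.cast_nonneg
  have hcard := Nat.Ico_filter_modEq_card a b hr v
  rw [max_eq_left (sub_nonneg.2 hmono)] at hcard
  have hcast : (((Finset.Ico a b).filter (· ≡ v [MOD r])).card : ℚ) =
      ⌈((b : ℚ) - v) / r⌉ - ⌈((a : ℚ) - v) / r⌉ := by exact_mod_cast hcard
  have hdiff : ((b : ℚ) - a) / r = (b - v) / r - (a - v) / r := by ring
  rw [hcast, hdiff, abs_lt]
  constructor <;>
    linarith [Int.le_ceil (((a : ℚ) - v) / r), Int.ceil_lt_add_one (((a : ℚ) - v) / r),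
      Int.le_ceil (((b : ℚ) - v) / r), Int.ceil_lt_add_one (((b : ℚ) - v) / r)]

theorem card_filter_modEq_le_add_one {a b r : ℕ} (hab : a ≤ b) (hr : 0 < r) (v w : ℕ) :
    ((Finset.Ico a b).filter (· ≡ v [MOD r])).card ≤
      ((Finset.Ico a b).filter (· ≡ w [MOD r])).card + 1 := by
  have hv := (abs_lt.1 (abs_card_filter_modEq_sub_lt_one hab hr v)).2
  have hw := (abs_lt.1 (abs_card_filter_modEq_sub_lt_one hab hr w)).1
  have hlt : (((Finset.Ico a b).filter (· ≡ v [MOD r])).card : ℚ) <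
      ((Finset.Ico a b).filter (· ≡ w [MOD r])).card + 2 := by linarith
  exact Nat.lt_succ_iff.1 (by exact_mod_cast hlt)

section RoundRobin

variable {K : ℕ} [NeZero K] {S : ℝ} {β : ℕ → ℝ} {order : Equiv.Perm (Fin K)}
  {y : ℕ → Fin K → ℝ} {s t : ℕ}

theorem explored_succ_of_none {t : ℕ} (h : (run S β order y t).leader = none) :
    (run S β order y (t + 1)).explored = (run S β order y t).explored + 1 := by
  simp only [run, Trace.step, h, if_true]

theorem explored_succ_of_some {t : ℕ} {a : Fin K} (h : (run S β order y t).leader = some a) :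
    (run S β order y (t + 1)).explored = (run S β order y t).explored := by
  simp only [run, Trace.step, h, reduceCtorEq, if_false, add_zero]

theorem monotone_explored : Monotone fun t => (run S β order y t).explored :=
  monotone_nat_of_le_succ fun _ => Nat.le_add_right _ _

theorem runArm_eq_iff_modEq {a : Fin K} (h : (run S β order y t).leader = none) :
    runArm S β order y t = a ↔ (run S β order y t).explored ≡ order.symm a [MOD K] := by
  simp only [runArm, Trace.arm, h, ← Equiv.eq_symm_apply, Fin.ext_iff, Nat.ModEq]
  rw [Nat.mod_eq_of_lt (order.symm a).isLt]
  rfl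

theorem explorePulls_eq_card_modEq (a : Fin K) (hst : s ≤ t) :
    statusPulls (runArm S β order y) a (fun t => (run S β order y t).leader ≠ some a) s t =
      ((Finset.Ico (run S β order y s).explored (run S β order y t).explored).filter
        (· ≡ order.symm a [MOD K])).card := by
  induction t, hst using Nat.le_induction with
  | base => simp [statusPulls_self]
  | succ t hst ih =>
    have hmono := monotone_explored (S := S) (β := β) (order := order) (y := y) hst
    cases hlead : (run S β order y t).leader with
    | none =>
      rw [explored_succ_of_none hlead, Nat.Ico_succ_right_eq_insert_Ico hmono,
        Finset.filter_insert]
      by_cases ha : runArm S β order y t = a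
      · rw [statusPulls_succ_of_pos hst ha (by simp [hlead]), ih,
          if_pos ((runArm_eq_iff_modEq hlead).1 ha), Finset.card_insert_of_notMem (by simp)]
      · rw [statusPulls_succ_of_neg hst fun h => ha h.1, ih,
          if_neg (mt (runArm_eq_iff_modEq hlead).2 ha)]
    | some b =>
      have hb : runArm S β order y t = b := Trace.arm_of_leader hlead
      rw [explored_succ_of_some hlead, statusPulls_succ_of_neg hst, ih]
      rintro ⟨rfl, hne⟩
      exact hne (by rw [hlead, hb])

theorem explorePulls_le_explorePulls_add_one (a b : Fin K) (hst : s ≤ t) :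
    statusPulls (runArm S β order y) a (fun t => (run S β order y t).leader ≠ some a) s t ≤
      statusPulls (runArm S β order y) b (fun t => (run S β order y t).leader ≠ some b) s t +
        1 := by
  rw [explorePulls_eq_card_modEq a hst, explorePulls_eq_card_modEq b hst]
  exact card_filter_modEq_le_add_one (monotone_explored hst) (Nat.pos_of_neZero K) _ _

end RoundRobin

/-! ### The shortfall on the good event -/

section SegmentShortfall

variable {K T : ℕ} [NeZero K] {S : ℝ} {order : Equiv.Perm (Fin K)} {y : ℕ → Fin K → ℝ}
  {m : Fin K → ℝ} {s e : ℕ} {a b : Fin K}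

theorem card_pulls_le (hse : s ≤ e)
    (hacc : Accurate (radius K T) m y (runArm S (radius K T) order y) s e)
    (ha : m a < S) (hb : S < m b) :
    (((Finset.Ico s e).filter (runArm S (radius K T) order y · = a)).card : ℝ) ≤
      16 * logFactor K T / (S - m a) ^ 2 + 16 * logFactor K T / (m b - S) ^ 2 + 3 := by
  have hlead := leadPulls_le hacc hse ha fun w =>
    two_mul_le_floor_of_le_two_mul_radius (sub_pos.2 ha)
  have hexplore := (explorePulls_le_explorePulls_add_one a b hse).trans <| Nat.succ_le_succ <|
    explorePulls_le hacc hse hb.le fun w => two_mul_le_floor_of_le_two_mul_radius (sub_pos.2 hb)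
  have hfloor (δ : ℝ) : (⌊16 * logFactor K T / δ ^ 2⌋₊ : ℝ) ≤ 16 * logFactor K T / δ ^ 2 :=
    Nat.floor_le (div_nonneg (mul_nonneg (by norm_num) (logFactor_nonneg K T)) (sq_nonneg δ))
  have hcard : (((Finset.Ico s e).filter (runArm S (radius K T) order y · = a)).card : ℝ) ≤
      (⌊16 * logFactor K T / (S - m a) ^ 2⌋₊ + 1) +
        (⌊16 * logFactor K T / (m b - S) ^ 2⌋₊ + 1 + 1) := by
    rw [← statusPulls_add_statusPulls_not _ a
      (fun t => (run S (radius K T) order y t).leader = some a)]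
    exact_mod_cast add_le_add hlead hexplore
  linarith [hfloor (S - m a), hfloor (m b - S)]

theorem sum_shortfall_le (hse : s ≤ e)
    (hacc : Accurate (radius K T) m y (runArm S (radius K T) order y) s e) (hb : S < m b) :
    ∑ τ ∈ Finset.Ico s e, max 0 (S - m (runArm S (radius K T) order y τ)) ≤
      ∑ a with m a < S,
        (16 * logFactor K T * (1 / (S - m a) + (S - m a) / (m b - S) ^ 2) + 3 * (S - m a)) := by
  rw [← Finset.sum_fiberwise (Finset.Ico s e) (runArm S (radius K T) order y), Finset.sum_filter]
  refine Finset.sum_le_sum fun a _ => ?_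
  have hfiber : ∑ τ ∈ Finset.Ico s e with runArm S (radius K T) order y τ = a,
      max 0 (S - m (runArm S (radius K T) order y τ)) =
        ((Finset.Ico s e).filter (runArm S (radius K T) order y · = a)).card *
          max 0 (S - m a) := by
    rw [Finset.sum_congr rfl fun τ hτ => by rw [(Finset.mem_filter.1 hτ).2], Finset.sum_const,
      nsmul_eq_mul]
  rw [hfiber]
  split_ifs with ha
  · have hδ : 0 < S - m a := sub_pos.2 ha
    rw [max_eq_right hδ.le]
    refine (mul_le_mul_of_nonneg_right (card_pulls_le hse hacc ha hb) hδ.le).trans_eq ?_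
    field_simp
  · rw [max_eq_left (sub_nonpos.2 (not_lt.1 ha)), mul_zero]

end SegmentShortfall

section ChangePoints

variable {K : ℕ} (μ : ℕ → Fin K → ℝ) {T : ℕ}

open Classical in
theorem count_isChangePoint (hT : 1 ≤ T) :
    Nat.count (IsChangePoint μ T) (T + 1) = numSegments μ T := by
  have himage : (Finset.range (T + 1)).filter (IsChangePoint μ T) =
      insert 1 (((Finset.Ico 1 T).filter (fun j => ∃ a, μ j a ≠ μ (j + 1) a)).image (· + 1)) := by
    ext t
    simp only [Finset.mem_filter, Finset.mem_range, IsChangePoint, Finset.mem_insert,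
      Finset.mem_image, Finset.mem_Ico]
    constructor
    · rintro ⟨hlt, rfl | rfl | ⟨h2, -, hne⟩⟩
      · exact .inl rfl
      · omega
      · refine .inr ⟨t - 1, ⟨by omega, ?_⟩, by omega⟩
        rwa [Nat.sub_add_cancel (by omega)]
    · rintro (rfl | ⟨j, ⟨hj, hne⟩, rfl⟩)
      · exact ⟨by omega, .inl rfl⟩
      · exact ⟨by omega, .inr (.inr ⟨by omega, by omega, hne⟩)⟩
  rw [Nat.count_eq_card_filter_range, numSegments, numSegmentsOn, himage,
    Finset.card_insert_of_notMem (by simp),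
    Finset.card_image_of_injective _ (add_left_injective 1), add_comm]

theorem changePoint_numSegments (hT : 1 ≤ T) : changePoint μ T (numSegments μ T) = T + 1 := by
  classical
  rw [changePoint, ← count_isChangePoint μ hT]
  exact Nat.nth_count (.inr (.inl rfl))

theorem changePoint_zero : changePoint μ T 0 = 1 := by
  classical
  have hcount : Nat.count (IsChangePoint μ T) 1 = 0 := by
    simp [Nat.count_succ, IsChangePoint]
  rw [changePoint, ← hcount]
  exact Nat.nth_count (.inl rfl)

theorem changePoint_mono (hT : 1 ≤ T) {k l : ℕ} (hkl : k ≤ l) (hl : l ≤ numSegments μ T) :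
    changePoint μ T k ≤ changePoint μ T l := by
  refine Nat.nth_le_nth' hkl fun hf => Nat.lt_card_toFinset_of_nth_ne_zero ?_ hf
  refine Nat.nth_ne_zero_anti (by simp [IsChangePoint]) hl ?_
  exact (changePoint_numSegments μ hT).trans_ne T.succ_ne_zero

theorem one_le_changePoint (hT : 1 ≤ T) {l : ℕ} (hl : l ≤ numSegments μ T) :
    1 ≤ changePoint μ T l :=
  (changePoint_zero μ).symm.trans_le (changePoint_mono μ hT l.zero_le hl)

theorem changePoint_le_succ (hT : 1 ≤ T) {l : ℕ} (hl : l ≤ numSegments μ T) :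
    changePoint μ T l ≤ T + 1 :=
  (changePoint_mono μ hT hl le_rfl).trans_eq (changePoint_numSegments μ hT)

theorem changePoint_mem_Icc (hT : 1 ≤ T) {l : ℕ} (hl : l < numSegments μ T) :
    changePoint μ T l ∈ Finset.Icc 1 T := by
  classical
  refine Finset.mem_Icc.2 ⟨one_le_changePoint μ hT hl.le, Nat.lt_succ_iff.1 ?_⟩
  exact Nat.nth_lt_of_lt_count (hl.trans_eq (count_isChangePoint μ hT).symm)

theorem eq_segMean (hT : 1 ≤ T) {l : ℕ} (hl : l < numSegments μ T) {t : ℕ}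
    (hlt : changePoint μ T l ≤ t) (htl : t < changePoint μ T (l + 1)) :
    μ t = segMean μ T l := by
  induction t, hlt using Nat.le_induction with
  | base => rfl
  | succ t ht ih =>
    rw [← ih (by omega)]
    by_contra hne
    have hchange : IsChangePoint μ T (t + 1) := by
      have hpos := one_le_changePoint μ hT hl.le
      have hle := changePoint_le_succ μ hT (show l + 1 ≤ _ from hl)
      refine .inr (.inr ⟨by omega, by omega, ?_⟩)
      exact Function.ne_iff.1 fun h => hne h.symm
    have hle : t + 1 ≤ changePoint μ T l := Nat.le_nth_of_lt_nth_succ htl hchange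
    omega

theorem sum_rounds_eq_sum_segments (hT : 1 ≤ T) (f : ℕ → ℝ) :
    ∑ t ∈ Finset.Icc 1 T, f t = ∑ l ∈ Finset.range (numSegments μ T),
      ∑ t ∈ Finset.Ico (changePoint μ T l) (changePoint μ T (l + 1)), f t := by
  have hpartial : ∀ n ≤ numSegments μ T, ∑ t ∈ Finset.Ico 1 (changePoint μ T n), f t =
      ∑ l ∈ Finset.range n,
        ∑ t ∈ Finset.Ico (changePoint μ T l) (changePoint μ T (l + 1)), f t := by
    intro n hn
    induction n with
    | zero => simp [changePoint_zero μ]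
    | succ n ih =>
      rw [Finset.sum_range_succ, ← ih (by omega), Finset.sum_Ico_consecutive _
        (one_le_changePoint μ hT (by omega)) (changePoint_mono μ hT n.le_succ hn)]
  rw [← hpartial _ le_rfl, changePoint_numSegments μ hT]
  rfl

end ChangePoints

/-- The instance-dependent sum in the regret bound, without the logarithmic factor. -/
noncomputable def complexity {K : ℕ} (S : ℝ) (μ : ℕ → Fin K → ℝ) (T : ℕ) : ℝ :=
  ∑ l ∈ Finset.range (numSegments μ T), ∑ a with segMean μ T l a < S,
    (1 / gap S μ T l a + gap S μ T l a / bestGap S μ T l ^ 2)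

section Shortfall

variable {K T : ℕ} {S : ℝ} {μ : ℕ → Fin K → ℝ} {Ω : Type*} {ξ : ℕ → Ω → Fin K → ℝ} {ω : Ω}

theorem gap_of_lt {l : ℕ} {a : Fin K} (ha : segMean μ T l a < S) :
    gap S μ T l a = S - segMean μ T l a :=
  max_eq_right (sub_pos.2 ha).le

theorem gap_nonneg (l : ℕ) (a : Fin K) : 0 ≤ gap S μ T l a := le_max_left _ _

theorem complexity_term_nonneg (l : ℕ) (a : Fin K) :
    0 ≤ 1 / gap S μ T l a + gap S μ T l a / bestGap S μ T l ^ 2 :=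
  add_nonneg (one_div_nonneg.2 (gap_nonneg l a)) (div_nonneg (gap_nonneg l a) (sq_nonneg _))

theorem complexity_nonneg : 0 ≤ complexity S μ T :=
  Finset.sum_nonneg fun l _ => Finset.sum_nonneg fun a _ => complexity_term_nonneg l a

theorem gap_le_one (hT : 1 ≤ T) (hμ : ∀ t ∈ Finset.Icc 1 T, ∀ a, S - μ t a ≤ 1) {l : ℕ}
    (hl : l < numSegments μ T) (a : Fin K) : gap S μ T l a ≤ 1 :=
  max_le zero_le_one (hμ _ (changePoint_mem_Icc μ hT hl) a)

theorem one_le_complexity_term (hT : 1 ≤ T) (hμ : ∀ t ∈ Finset.Icc 1 T, ∀ a, S - μ t a ≤ 1)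
    {l : ℕ} (hl : l < numSegments μ T) {a : Fin K} (ha : segMean μ T l a < S) :
    1 ≤ 1 / gap S μ T l a + gap S μ T l a / bestGap S μ T l ^ 2 := by
  have hpos : 0 < gap S μ T l a := gap_of_lt ha ▸ sub_pos.2 ha
  exact (one_le_one_div hpos (gap_le_one hT hμ hl a)).trans
    (le_add_of_nonneg_right (div_nonneg hpos.le (sq_nonneg _)))

theorem gap_le_complexity (hT : 1 ≤ T) (hμ : ∀ t ∈ Finset.Icc 1 T, ∀ a, S - μ t a ≤ 1) {l : ℕ}
    (hl : l < numSegments μ T) (a : Fin K) : gap S μ T l a ≤ complexity S μ T := by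
  rcases lt_or_ge (segMean μ T l a) S with ha | ha
  · calc gap S μ T l a
        ≤ 1 / gap S μ T l a + gap S μ T l a / bestGap S μ T l ^ 2 :=
          (gap_le_one hT hμ hl a).trans (one_le_complexity_term hT hμ hl ha)
      _ ≤ ∑ a with segMean μ T l a < S,
            (1 / gap S μ T l a + gap S μ T l a / bestGap S μ T l ^ 2) :=
          Finset.single_le_sum
            (f := fun a => 1 / gap S μ T l a + gap S μ T l a / bestGap S μ T l ^ 2)
            (fun a _ => complexity_term_nonneg l a) (by simpa using ha)
      _ ≤ complexity S μ T :=
          Finset.single_le_sum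
            (f := fun l => ∑ a with segMean μ T l a < S,
              (1 / gap S μ T l a + gap S μ T l a / bestGap S μ T l ^ 2))
            (fun l _ => Finset.sum_nonneg fun a _ => complexity_term_nonneg l a)
            (Finset.mem_range.2 hl)
  · rw [gap, max_eq_left (sub_nonpos.2 ha)]
    exact complexity_nonneg

theorem shortfall_nonneg (π : Policy K) : 0 ≤ shortfall S T π μ ξ ω :=
  Finset.sum_nonneg fun _ _ => le_max_left _ _

theorem shortfall_le_mul_complexity (hT : 1 ≤ T)
    (hμ : ∀ t ∈ Finset.Icc 1 T, ∀ a, S - μ t a ≤ 1) (π : Policy K) :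
    shortfall S T π μ ξ ω ≤ T * complexity S μ T := by
  have hconst : (T : ℝ) * complexity S μ T = ∑ _ ∈ Finset.Icc 1 T, complexity S μ T := by simp
  rw [hconst, shortfall, sum_rounds_eq_sum_segments μ hT, sum_rounds_eq_sum_segments μ hT]
  refine Finset.sum_le_sum fun l hl => Finset.sum_le_sum fun t ht => ?_
  rw [Finset.mem_range] at hl
  rw [Finset.mem_Ico] at ht
  rw [eq_segMean μ hT hl ht.1 ht.2]
  exact gap_le_complexity hT hμ hl (action π μ ξ t ω)

variable [NeZero K] {order : Equiv.Perm (Fin K)}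

theorem segment_shortfall_le (hT : 1 ≤ T) (hS : Realizable S μ T)
    (hz : Concentrated (radius K T)
      (runArm S (radius K T) order fun τ a => μ (τ + 1) a + ξ (τ + 1) ω a)
      (fun τ => ξ (τ + 1) ω) T) {l : ℕ} (hl : l < numSegments μ T) :
    ∑ t ∈ Finset.Ico (changePoint μ T l) (changePoint μ T (l + 1)),
        max 0 (S - μ t (action (nonstationarySat K T S order) μ ξ t ω)) ≤
      ∑ a with segMean μ T l a < S,
        (16 * logFactor K T * (1 / gap S μ T l a + gap S μ T l a / bestGap S μ T l ^ 2) +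
          3 * gap S μ T l a) := by
  obtain ⟨s, hs⟩ := Nat.exists_eq_add_of_le' (one_le_changePoint μ hT hl.le)
  obtain ⟨e, he⟩ := Nat.exists_eq_add_of_le'
    (one_le_changePoint μ hT (show l + 1 ≤ numSegments μ T from hl))
  have hse : changePoint μ T l ≤ changePoint μ T (l + 1) := changePoint_mono μ hT l.le_succ hl
  have heT : changePoint μ T (l + 1) ≤ T + 1 := changePoint_le_succ μ hT hl
  have hmean : ∀ τ, s ≤ τ → τ < e → μ (τ + 1) = segMean μ T l := fun τ hsτ hτe =>
    eq_segMean μ hT hl (by omega) (by omega)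
  have hacc := hz.accurate (s := s) (e := e) (by omega)
    (y := fun τ a => μ (τ + 1) a + ξ (τ + 1) ω a) (m := segMean μ T l)
    fun τ hsτ hτe a => by rw [hmean τ hsτ hτe]
  obtain ⟨b, hb⟩ := exists_eq_ciSup_of_finite (f := segMean μ T l)
  have hbS : S < segMean μ T l b := hb ▸ hS l hl
  calc _ = ∑ τ ∈ Finset.Ico s e, max 0 (S - segMean μ T l (runArm S (radius K T) order
        (fun τ a => μ (τ + 1) a + ξ (τ + 1) ω a) τ)) := by
        rw [hs, he, ← Finset.sum_Ico_add' _ s e 1]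
        refine Finset.sum_congr rfl fun τ hτ => ?_
        rw [Finset.mem_Ico] at hτ
        rw [hmean τ hτ.1 hτ.2, action_succ]
    _ ≤ _ := sum_shortfall_le (by omega) hacc hbS
    _ = _ := by
        refine Finset.sum_congr rfl fun a ha => ?_
        rw [gap_of_lt (Finset.mem_filter.1 ha).2, bestGap, bestMean, hb]

theorem shortfall_le_of_concentrated (hT : 1 ≤ T)
    (hμ : ∀ t ∈ Finset.Icc 1 T, ∀ a, S - μ t a ≤ 1) (hS : Realizable S μ T)
    (hz : Concentrated (radius K T)
      (runArm S (radius K T) order fun τ a => μ (τ + 1) a + ξ (τ + 1) ω a)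
      (fun τ => ξ (τ + 1) ω) T) :
    shortfall S T (nonstationarySat K T S order) μ ξ ω ≤
      (16 * logFactor K T + 3) * complexity S μ T := by
  rw [shortfall, sum_rounds_eq_sum_segments μ hT, complexity, Finset.mul_sum]
  refine Finset.sum_le_sum fun l hl => ?_
  rw [Finset.mem_range] at hl
  refine (segment_shortfall_le hT hS hz hl).trans ?_
  rw [Finset.mul_sum]
  refine Finset.sum_le_sum fun a ha => ?_
  have hgap := (gap_le_one hT hμ hl a).trans
    (one_le_complexity_term hT hμ hl (Finset.mem_filter.1 ha).2)
  linarith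

end Shortfall

/-! ### Measurability of the run -/

section Measurability

variable {K : ℕ}

/-- All sets of traces are measurable; as there are only countably many traces, no generality is
lost. -/
instance : MeasurableSpace (Trace K) := ⊤

instance : DiscreteMeasurableSpace (Trace K) := ⟨fun _ => trivial⟩

instance : Countable (Trace K) :=
  Function.Injective.countable (f := fun x : Trace K => (x.leader, x.buffer, x.explored))
    fun _ _ h => Trace.ext (congrArg Prod.fst h) (congrArg (·.2.1) h) (congrArg (·.2.2) h)

theorem measurable_avgLast_map {ι : Type*} (L : List ℕ) (a : ι) (w : ℕ) :
    Measurable fun y : ℕ → ι → ℝ => avgLast (L.map (y · a)) w := by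
  simp only [avgLast, List.length_map, ← List.map_drop]
  refine Measurable.div_const ?_ _
  induction L.drop (L.length - w) with
  | nil => exact measurable_const
  | cons τ L ih =>
    simp only [List.map_cons, List.sum_cons]
    exact Measurable.add (by fun_prop) ih

theorem measurableSet_le_lcbWin {ι : Type*} (S : ℝ) (β : ℕ → ℝ) (L : List ℕ) (a : ι) :
    MeasurableSet {y : ℕ → ι → ℝ | (S : EReal) ≤ lcbWin β (L.map (y · a))} := by
  simp only [le_lcbWin_iff, List.length_map, ← exists_prop, Set.ofPred_exists]
  exact Finset.measurableSet_biUnion _ fun w _ =>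
    measurableSet_le measurable_const ((measurable_avgLast_map L a w).sub_const _)

theorem measurableSet_ucbWin_lt {ι : Type*} (S : ℝ) (β : ℕ → ℝ) (L : List ℕ) (a : ι) :
    MeasurableSet {y : ℕ → ι → ℝ | ucbWin β (L.map (y · a)) < (S : EReal)} := by
  simp only [ucbWin_lt_iff, List.length_map, ← exists_prop, Set.ofPred_exists]
  exact Finset.measurableSet_biUnion _ fun w _ =>
    measurableSet_lt ((measurable_avgLast_map L a w).add_const _) measurable_const

variable [NeZero K] (S : ℝ) (β : ℕ → ℝ) (order : Equiv.Perm (Fin K))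

theorem Trace.measurableSet_switches (t : ℕ) (x : Trace K) :
    MeasurableSet {y | x.Switches S β order y t} := by
  by_cases hx : x.leader = none
  · simpa only [Trace.Switches, hx, if_true] using
      measurableSet_le_lcbWin S β (x.buffer (x.arm order) ++ [t]) (x.arm order)
  · simpa only [Trace.Switches, hx, if_false] using
      measurableSet_ucbWin_lt S β (x.buffer (x.arm order) ++ [t]) (x.arm order)

theorem Trace.step_factorsThrough (t : ℕ) (x : Trace K) :
    Function.FactorsThrough (fun y => x.step S β order y t)
      (fun y => x.Switches S β order y t) :=
  fun y y' (h : x.Switches S β order y t = x.Switches S β order y' t) => by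
    simp only [Trace.step]
    rw [h]

theorem Trace.measurable_step (t : ℕ) (x : Trace K) :
    Measurable fun y => x.step S β order y t := by
  rw [← (x.step_factorsThrough S β order t).extend_comp fun _ => x]
  exact (measurable_of_countable _).comp
    (measurableSet_setOfPred.1 (x.measurableSet_switches S β order t))

theorem measurable_run (t : ℕ) : Measurable fun y => run S β order y t := by
  induction t with
  | zero => exact measurable_const
  | succ t ih =>
    have hstep : Measurable fun p : (ℕ → Fin K → ℝ) × Trace K => p.2.step S β order p.1 t :=
      measurable_from_prod_countable_left fun x => x.measurable_step S β order t
    exact hstep.comp (measurable_id.prodMk ih)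

theorem measurable_runArm (t : ℕ) : Measurable fun y => runArm S β order y t :=
  (measurable_of_countable (Trace.arm order)).comp (measurable_run S β order t)

variable {S β order}

theorem lt_of_mem_buffer_run {y : ℕ → Fin K → ℝ} {t τ : ℕ} {a : Fin K}
    (h : τ ∈ (run S β order y t).buffer a) : τ < t := by
  induction t with
  | zero => exact absurd h List.not_mem_nil
  | succ t ih =>
    rw [run] at h
    by_cases ha : (run S β order y t).arm order = a
    · by_cases hs : (run S β order y t).Switches S β order y t
      · rw [Trace.buffer_step_of_switches ha hs] at h
        exact absurd h List.not_mem_nil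
      · rw [Trace.buffer_step_of_not_switches ha hs, List.mem_append, List.mem_singleton] at h
        exact Nat.lt_succ_iff.2 (h.elim (fun h => (ih h).le) Eq.le)
    · rw [Trace.buffer_step_of_ne ha] at h
      exact (ih h).trans t.lt_succ_self

theorem Trace.step_congr {y y' : ℕ → Fin K → ℝ} {t : ℕ} {x : Trace K}
    (h : ∀ τ ∈ x.buffer (x.arm order) ++ [t], y τ = y' τ) :
    x.step S β order y t = x.step S β order y' t := by
  have hmap : (x.buffer (x.arm order) ++ [t]).map (y · (x.arm order)) =
      (x.buffer (x.arm order) ++ [t]).map (y' · (x.arm order)) :=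
    List.map_congr_left fun τ hτ => congrFun (h τ hτ) _
  refine x.step_factorsThrough S β order t ?_
  simp only [Trace.Switches, hmap]

theorem run_congr {y y' : ℕ → Fin K → ℝ} {t : ℕ} (h : ∀ τ < t, y τ = y' τ) :
    run S β order y t = run S β order y' t := by
  induction t with
  | zero => rfl
  | succ t ih =>
    rw [run, run, ← ih fun τ hτ => h τ (hτ.trans t.lt_succ_self)]
    refine Trace.step_congr fun τ hτ => h τ ?_
    rw [List.mem_append, List.mem_singleton] at hτ
    exact Nat.lt_succ_iff.2 (hτ.elim (fun hτ => (lt_of_mem_buffer_run hτ).le) Eq.le)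

theorem measurable_runArm_of_lt {Ω : Type*} {m : MeasurableSpace Ω} {Y : Ω → ℕ → Fin K → ℝ}
    {t : ℕ} (hY : ∀ τ < t, Measurable fun ω => Y ω τ) :
    Measurable fun ω => runArm S β order (Y ω) t := by
  have htrunc : Measurable fun ω τ => if τ < t then Y ω τ else 0 := by
    refine measurable_pi_lambda _ fun τ => ?_
    split_ifs with hτ
    exacts [hY τ hτ, measurable_const]
  have hrun : ∀ ω, runArm S β order (Y ω) t =
      runArm S β order (fun τ => if τ < t then Y ω τ else 0) t := fun ω =>
    congrArg (Trace.arm order) (run_congr fun τ hτ => (if_pos hτ).symm)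
  simp only [hrun]
  exact (measurable_runArm S β order t).comp htrunc

end Measurability

/-! ### Concentration of the noise over adaptively chosen rounds -/

section Supermartingale

variable {Ω : Type*} {mΩ : MeasurableSpace Ω} {P : Measure Ω}

theorem lintegral_mul_ite_one_le {m : MeasurableSpace Ω} (hm : m ≤ mΩ) {W X : Ω → ENNReal}
    {p : Ω → Prop} [DecidablePred p] (hW : Measurable[m] W) (hp : MeasurableSet[m] {ω | p ω})
    (hX : Measurable[mΩ] X) (hind : Indep m (MeasurableSpace.comap X inferInstance) P)
    (hX1 : ∫⁻ ω, X ω ∂P ≤ 1) :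
    ∫⁻ ω, W ω * (if p ω then X ω else 1) ∂P ≤ ∫⁻ ω, W ω ∂P := by
  set A : Set Ω := {ω | p ω}
  have hsplit : ∀ ω, W ω * (if p ω then X ω else 1) =
      A.indicator W ω * X ω + Aᶜ.indicator W ω := by
    intro ω
    by_cases hω : p ω <;> simp [A, hω]
  calc ∫⁻ ω, W ω * (if p ω then X ω else 1) ∂P
      = ∫⁻ ω, A.indicator W ω * X ω ∂P + ∫⁻ ω, Aᶜ.indicator W ω ∂P := by
        simp only [hsplit]
        exact lintegral_add_right _ ((hW.mono hm le_rfl).indicator (hm _ hp).compl)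
    _ = (∫⁻ ω, A.indicator W ω ∂P) * (∫⁻ ω, X ω ∂P) + ∫⁻ ω, Aᶜ.indicator W ω ∂P := by
        rw [lintegral_mul_eq_lintegral_mul_lintegral_of_independent_measurableSpace hm
          hX.comap_le hind (hW.indicator hp) (comap_measurable X)]
    _ ≤ ∫⁻ ω, A.indicator W ω ∂P + ∫⁻ ω, Aᶜ.indicator W ω ∂P := by
        gcongr
        exact mul_le_of_le_one_right' hX1
    _ = ∫⁻ ω, W ω ∂P := by
        rw [lintegral_indicator (hm _ hp), lintegral_indicator (hm _ hp).compl,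
          lintegral_add_compl W (hm _ hp)]

variable {ℱ : Filtration ℕ mΩ}

theorem lintegral_prod_filter_le_one [IsProbabilityMeasure P] {X : ℕ → Ω → ENNReal}
    {p : ℕ → Ω → Prop} [∀ n, DecidablePred (p n)] (hX : ∀ n, Measurable[ℱ (n + 1)] (X n))
    (hind : ∀ n, Indep (ℱ n) (MeasurableSpace.comap (X n) inferInstance) P)
    (hX1 : ∀ n, ∫⁻ ω, X n ω ∂P ≤ 1) (hp : ∀ n, MeasurableSet[ℱ n] {ω | p n ω}) (s : Finset ℕ) :
    ∫⁻ ω, ∏ n ∈ s with p n ω, X n ω ∂P ≤ 1 := by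
  simp only [Finset.prod_filter]
  induction s using Finset.induction_on_max with
  | empty => simp
  | insert n s hlt ih =>
    have hpast : Measurable[ℱ n] fun ω => ∏ k ∈ s, if p k ω then X k ω else 1 :=
      Finset.measurable_prod _ fun k hk => Measurable.ite (ℱ.mono (hlt k hk).le _ (hp k))
        ((hX k).mono (ℱ.mono (hlt k hk)) le_rfl) measurable_const
    simp only [Finset.prod_insert fun hn => (hlt n hn).false, mul_comm (ite (p n _) _ _)]
    exact (lintegral_mul_ite_one_le (ℱ.le n) hpast (hp n) ((hX n).mono (ℱ.le _) le_rfl)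
      (hind n) (hX1 n)).trans ih

theorem lintegral_exp_sub_le_one [IsProbabilityMeasure P] {ζ : Ω → ℝ} {c : NNReal}
    (h : HasSubgaussianMGF ζ c P) (l : ℝ) :
    ∫⁻ ω, ENNReal.ofReal (Real.exp (l * ζ ω - c * l ^ 2 / 2)) ∂P ≤ 1 := by
  simp only [sub_eq_add_neg, Real.exp_add]
  rw [← ofReal_integral_eq_lintegral_ofReal ((h.integrable_exp_mul l).mul_const _)
    (.of_forall fun ω => by positivity), integral_mul_const, ENNReal.ofReal_le_one]
  calc mgf ζ P l * Real.exp (-(c * l ^ 2 / 2))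
      ≤ Real.exp (c * l ^ 2 / 2) * Real.exp (-(c * l ^ 2 / 2)) := by
        gcongr
        exact h.mgf_le l
    _ = 1 := by rw [← Real.exp_add, add_neg_cancel, Real.exp_zero]

/-- The sequence `ζ` is a sub-Gaussian innovation of the filtration `ℱ` with variance proxy `c`:
`ζ n` is revealed at time `n + 1` and independent of what is known at time `n`. -/
structure IsSubgaussianInnovation (P : Measure Ω) (ℱ : Filtration ℕ mΩ) (c : NNReal)
    (ζ : ℕ → Ω → ℝ) : Prop where
  measurable (n : ℕ) : Measurable[ℱ (n + 1)] (ζ n)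
  indep (n : ℕ) : Indep (ℱ n) (MeasurableSpace.comap (ζ n) inferInstance) P
  subgaussian (n : ℕ) : HasSubgaussianMGF (ζ n) c P

variable {c : NNReal} {ζ : ℕ → Ω → ℝ}

theorem IsSubgaussianInnovation.indep_comp {E : Type*} [MeasurableSpace E] {f : ℝ → E}
    (hζ : IsSubgaussianInnovation P ℱ c ζ) (hf : Measurable f) (n : ℕ) :
    Indep (ℱ n) (MeasurableSpace.comap (fun ω => f (ζ n ω)) inferInstance) P :=
  indep_of_indep_of_le_right (hζ.indep n) (hf.comp (comap_measurable (ζ n))).comap_le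

theorem IsSubgaussianInnovation.neg (hζ : IsSubgaussianInnovation P ℱ c ζ) :
    IsSubgaussianInnovation P ℱ c (-ζ) where
  measurable n := (hζ.measurable n).neg
  indep n := hζ.indep_comp measurable_neg n
  subgaussian n := (hζ.subgaussian n).neg

variable [IsProbabilityMeasure P] {ι : Type*} [DecidableEq ι] [MeasurableSpace ι]
  [MeasurableSingletonClass ι] {α : ℕ → Ω → ι}

theorem IsSubgaussianInnovation.lintegral_exp_sum_le_one
    (hζ : IsSubgaussianInnovation P ℱ c ζ) (hα : ∀ n, Measurable[ℱ n] (α n)) (a : ι)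
    (s : Finset ℕ) (l : ℝ) :
    ∫⁻ ω, ENNReal.ofReal (Real.exp (∑ n ∈ s with α n ω = a, (l * ζ n ω - c * l ^ 2 / 2))) ∂P ≤
      1 := by
  have hf : Measurable fun x : ℝ => ENNReal.ofReal (Real.exp (l * x - c * l ^ 2 / 2)) := by
    fun_prop
  simp only [Real.exp_sum, ENNReal.ofReal_prod_of_nonneg fun _ _ => Real.exp_nonneg _]
  exact lintegral_prod_filter_le_one (fun n => hf.comp (hζ.measurable n)) (hζ.indep_comp hf)
    (fun n => lintegral_exp_sub_le_one (hζ.subgaussian n) l)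
    (fun n => hα n (measurableSet_singleton a)) s

theorem IsSubgaussianInnovation.measure_le_sum_le
    (hζ : IsSubgaussianInnovation P ℱ c ζ) (hα : ∀ n, Measurable[ℱ n] (α n)) (a : ι)
    (s : Finset ℕ) (k : ℕ) {b : ℝ} (hb : 0 ≤ b) :
    P {ω | (s.filter (α · ω = a)).card = k ∧ k * b ≤ ∑ n ∈ s with α n ω = a, ζ n ω} ≤
      ENNReal.ofReal (Real.exp (-(k * b ^ 2 / (2 * c)))) := by
  set W : Ω → ENNReal := fun ω => ENNReal.ofReal
    (Real.exp (∑ n ∈ s with α n ω = a, (b / c * ζ n ω - c * (b / c) ^ 2 / 2))) with hW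
  have hWm : Measurable W := by
    simp only [hW, Finset.sum_filter]
    exact (Finset.measurable_sum _ fun n _ => Measurable.ite
      (ℱ.le n _ (hα n (measurableSet_singleton a)))
      ((((hζ.measurable n).mono (ℱ.le _) le_rfl).const_mul _).sub_const _)
      measurable_const).exp.ennreal_ofReal
  have hpos : 0 < Real.exp (k * b ^ 2 / (2 * c)) := Real.exp_pos _
  have hsquare : c * (b / c) ^ 2 / 2 = b / c * b / 2 := by
    rcases eq_or_ne (c : ℝ) 0 with hc | hc
    · simp [hc]
    · field_simp
  calc _ ≤ P {ω | ENNReal.ofReal (Real.exp (k * b ^ 2 / (2 * c))) ≤ W ω} := by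
        refine measure_mono fun ω hω => ENNReal.ofReal_le_ofReal (Real.exp_le_exp.2 ?_)
        obtain ⟨hcard, hsum⟩ := hω
        rw [Finset.sum_sub_distrib, Finset.sum_const, hcard, ← Finset.mul_sum, nsmul_eq_mul,
          hsquare]
        have hscaled := mul_le_mul_of_nonneg_left hsum (div_nonneg hb c.coe_nonneg)
        calc k * b ^ 2 / (2 * c) = b / c * (k * b) - k * (b / c * b / 2) := by ring
          _ ≤ _ := sub_le_sub_right hscaled _
    _ ≤ (∫⁻ ω, W ω ∂P) / ENNReal.ofReal (Real.exp (k * b ^ 2 / (2 * c))) :=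
        meas_ge_le_lintegral_div hWm.aemeasurable (ENNReal.ofReal_pos.2 hpos).ne'
          ENNReal.ofReal_ne_top
    _ ≤ 1 / ENNReal.ofReal (Real.exp (k * b ^ 2 / (2 * c))) :=
        ENNReal.div_le_div_right (hζ.lintegral_exp_sum_le_one hα a s (b / c)) _
    _ = _ := by rw [one_div, ← ENNReal.ofReal_inv_of_pos hpos, Real.exp_neg]

theorem IsSubgaussianInnovation.measure_le_abs_sum_le
    (hζ : IsSubgaussianInnovation P ℱ c ζ) (hα : ∀ n, Measurable[ℱ n] (α n)) (a : ι)
    (s : Finset ℕ) (k : ℕ) {b : ℝ} (hb : 0 ≤ b) :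
    P {ω | (s.filter (α · ω = a)).card = k ∧ k * b ≤ |∑ n ∈ s with α n ω = a, ζ n ω|} ≤
      2 * ENNReal.ofReal (Real.exp (-(k * b ^ 2 / (2 * c)))) := by
  rw [two_mul]
  refine (measure_mono fun ω hω => ?_).trans ((measure_union_le _ _).trans
    (add_le_add (hζ.measure_le_sum_le hα a s k hb) (hζ.neg.measure_le_sum_le hα a s k hb)))
  simpa only [Set.mem_union, Set.mem_ofPred_eq, ← and_or_left, Pi.neg_apply,
    Finset.sum_neg_distrib, ← le_abs] using hω

end Supermartingale

section UnionBound

variable {Ω : Type*} {mΩ : MeasurableSpace Ω} {P : Measure Ω} {ℱ : Filtration ℕ mΩ}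
  {ι : Type*} [DecidableEq ι] {β : ℕ → ℝ} {z : ℕ → ι → ℝ}

theorem exists_lt_abs_sum_of_not_concentrated {α : ℕ → ι} {T : ℕ}
    (h : ¬Concentrated β α z T) :
    ∃ a, ∃ u ∈ Finset.range T, ∃ t ∈ Finset.Icc 1 T, ∃ k ∈ Finset.Icc 1 T,
      ((Finset.Ico u t).filter (α · = a)).card = k ∧
        k * β k ≤ |∑ τ ∈ Finset.Ico u t with α τ = a, z τ a| := by
  simp only [Concentrated, not_forall, not_le] at h
  obtain ⟨a, u, t, htT, hlt⟩ := h
  have hpos : 0 < ((Finset.Ico u t).filter (α · = a)).card := by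
    by_contra! h0
    rw [Nat.le_zero, Finset.card_eq_zero] at h0
    simp [h0] at hlt
  have hle : ((Finset.Ico u t).filter (α · = a)).card ≤ t - u :=
    (Finset.card_filter_le _ _).trans_eq (Nat.card_Ico u t)
  refine ⟨a, u, Finset.mem_range.2 ?_, t, Finset.mem_Icc.2 ?_, _, Finset.mem_Icc.2 ?_, rfl,
    hlt.le⟩ <;> omega

theorem measure_not_concentrated_le [IsProbabilityMeasure P] [Fintype ι] [MeasurableSpace ι]
    [MeasurableSingletonClass ι] {c : NNReal} {ζ : ℕ → Ω → ι → ℝ} {α : ℕ → Ω → ι}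
    (hζ : ∀ a, IsSubgaussianInnovation P ℱ c fun τ ω => ζ τ ω a)
    (hα : ∀ τ, Measurable[ℱ τ] (α τ)) {T : ℕ} {κ : ℝ} (hβ : ∀ k, 0 ≤ β k)
    (hκ : ∀ k, 1 ≤ k → κ ≤ k * β k ^ 2 / (2 * c)) :
    P {ω | ¬Concentrated β (α · ω) (ζ · ω) T} ≤
      Fintype.card ι * T ^ 3 * (2 * ENNReal.ofReal (Real.exp (-κ))) := by
  let E (i : ι × ℕ × ℕ × ℕ) : Set Ω :=
    {ω | ((Finset.Ico i.2.1 i.2.2.1).filter (α · ω = i.1)).card = i.2.2.2 ∧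
      i.2.2.2 * β i.2.2.2 ≤ |∑ τ ∈ Finset.Ico i.2.1 i.2.2.1 with α τ ω = i.1, ζ τ ω i.1|}
  let I : Finset (ι × ℕ × ℕ × ℕ) :=
    Finset.univ ×ˢ Finset.range T ×ˢ Finset.Icc 1 T ×ˢ Finset.Icc 1 T
  have hsub : {ω | ¬Concentrated β (α · ω) (ζ · ω) T} ⊆ ⋃ i ∈ I, E i := by
    intro ω hω
    obtain ⟨a, u, hu, t, ht, k, hk, hE⟩ := exists_lt_abs_sum_of_not_concentrated hω
    have hI : (a, u, t, k) ∈ I := by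
      simp only [I, Finset.mem_product, Finset.mem_univ, hu, ht, hk, and_self]
    exact Set.mem_biUnion hI hE
  have hE : ∀ i ∈ I, P (E i) ≤ 2 * ENNReal.ofReal (Real.exp (-κ)) := by
    intro i hi
    simp only [I, Finset.mem_product, Finset.mem_Icc] at hi
    refine ((hζ i.1).measure_le_abs_sum_le hα i.1 _ _ (hβ _)).trans ?_
    gcongr
    exact hκ _ hi.2.2.2.1
  calc P {ω | ¬Concentrated β (α · ω) (ζ · ω) T}
      ≤ ∑ i ∈ I, P (E i) := (measure_mono hsub).trans (measure_biUnion_finset_le _ _)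
    _ ≤ ∑ i ∈ I, 2 * ENNReal.ofReal (Real.exp (-κ)) := Finset.sum_le_sum hE
    _ = Fintype.card ι * T ^ 3 * (2 * ENNReal.ofReal (Real.exp (-κ))) := by
        simp only [Finset.sum_const, I, Finset.card_product, Finset.card_univ, Finset.card_range,
          Nat.card_Icc, Nat.add_sub_cancel, nsmul_eq_mul, Nat.cast_mul]
        ring

end UnionBound

/-! ### The regret -/

theorem integral_le_add_measureReal_mul {Ω : Type*} [MeasurableSpace Ω] {P : Measure Ω}
    [IsProbabilityMeasure P] {f : Ω → ℝ} (hf : Integrable f P) {s : Set Ω} {B M : ℝ} (hB : 0 ≤ B)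
    (hM : ∀ ω, f ω ≤ M) (hs : ∀ ω ∉ s, f ω ≤ B) : ∫ ω, f ω ∂P ≤ B + P.real s * M := by
  have hmeas : MeasurableSet (toMeasurable P s) := measurableSet_toMeasurable P s
  have hind : Integrable ((toMeasurable P s).indicator fun _ => M) P :=
    (integrable_const M).indicator hmeas
  have hpt : ∀ ω, f ω ≤ B + (toMeasurable P s).indicator (fun _ => M) ω := by
    intro ω
    by_cases hω : ω ∈ toMeasurable P s
    · rw [Set.indicator_of_mem hω]
      exact (hM ω).trans (le_add_of_nonneg_left hB)
    · rw [Set.indicator_of_notMem hω, add_zero]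
      exact hs ω fun h => hω (subset_toMeasurable P s h)
  calc ∫ ω, f ω ∂P ≤ ∫ ω, (B + (toMeasurable P s).indicator (fun _ => M) ω) ∂P :=
        integral_mono hf ((integrable_const B).add hind) hpt
    _ = B + P.real s * M := by
        rw [integral_add (integrable_const B) hind, integral_indicator_const M hmeas,
          integral_const, probReal_univ, one_smul, smul_eq_mul, measureReal_def,
          measure_toMeasurable, ← measureReal_def]

section Noise

variable {K T : ℕ} {Ω : Type*} [MeasurableSpace Ω] {P : Measure Ω} {ξ : ℕ → Ω → Fin K → ℝ}

/-- The filtration of the noise. With rounds numbered from `0`, round `τ` has the noise `ξ (τ + 1)`,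
so that the noise of the rounds before `t` is known at time `t`. -/
noncomputable def IsNoise.filtration (hξ : IsNoise P ξ) : Filtration ℕ ‹MeasurableSpace Ω› :=
  Filtration.natural ξ fun t => (hξ.measurable t).stronglyMeasurable

theorem IsNoise.measurable_filtration (hξ : IsNoise P ξ) {τ t : ℕ} (hτ : τ ≤ t) :
    Measurable[hξ.filtration t] (ξ τ) :=
  (Filtration.stronglyAdapted_natural _ τ).measurable.mono (hξ.filtration.mono hτ) le_rfl

theorem IsNoise.isSubgaussianInnovation (hξ : IsNoise P ξ) (a : Fin K) :
    IsSubgaussianInnovation P hξ.filtration 1 fun τ ω => ξ (τ + 1) ω a where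
  measurable _ := (measurable_pi_apply a).comp (hξ.measurable_filtration le_rfl)
  indep τ := indep_of_indep_of_le_right
    (hξ.indep.indep_comap_natural_of_lt (fun t => (hξ.measurable t).stronglyMeasurable)
      τ.lt_succ_self).symm
    ((measurable_pi_apply a).comp (comap_measurable (ξ (τ + 1)))).comap_le
  subgaussian τ := hξ.subGaussian (τ + 1) a

variable [NeZero K] {S : ℝ} {order : Equiv.Perm (Fin K)} {μ : ℕ → Fin K → ℝ}

theorem IsNoise.measurable_runArm (hξ : IsNoise P ξ) (β : ℕ → ℝ) (t : ℕ) :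
    Measurable[hξ.filtration t] fun ω =>
      runArm S β order (fun τ a => μ (τ + 1) a + ξ (τ + 1) ω a) t :=
  measurable_runArm_of_lt fun _ hτ => measurable_const.add (hξ.measurable_filtration hτ)

theorem IsNoise.measurable_shortfall (hξ : IsNoise P ξ) :
    Measurable (shortfall S T (nonstationarySat K T S order) μ ξ) := by
  refine Finset.measurable_sum _ fun t ht => ?_
  obtain ⟨t, rfl⟩ := Nat.exists_eq_add_of_le' (Finset.mem_Icc.1 ht).1
  simp only [action_succ]
  exact (measurable_of_countable fun a => max 0 (S - μ (t + 1) a)).comp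
    ((hξ.measurable_runArm _ t).mono (hξ.filtration.le t) le_rfl)

theorem IsNoise.integrable_shortfall [IsFiniteMeasure P] (hξ : IsNoise P ξ) (hT : 1 ≤ T)
    (hμ : ∀ t ∈ Finset.Icc 1 T, ∀ a, S - μ t a ≤ 1) :
    Integrable (shortfall S T (nonstationarySat K T S order) μ ξ) P :=
  .of_bound hξ.measurable_shortfall.aestronglyMeasurable (T * complexity S μ T)
    (.of_forall fun _ => by
      rw [Real.norm_of_nonneg (shortfall_nonneg _)]
      exact shortfall_le_mul_complexity hT hμ _)

theorem IsNoise.measureReal_not_concentrated_le [IsProbabilityMeasure P] (hξ : IsNoise P ξ)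
    (hT : 1 ≤ T) :
    P.real {ω | ¬Concentrated (radius K T)
      (runArm S (radius K T) order fun τ a => μ (τ + 1) a + ξ (τ + 1) ω a)
      (fun τ => ξ (τ + 1) ω) T} ≤ 2 / T := by
  have hT0 : (0 : ℝ) < T := by exact_mod_cast hT
  have hK0 : (0 : ℝ) < K := by exact_mod_cast NeZero.pos K
  have hκ : ∀ k : ℕ, 1 ≤ k → logFactor K T ≤ k * radius K T k ^ 2 / (2 * (1 : NNReal)) := by
    intro k hk
    have hk0 : (k : ℝ) ≠ 0 := by positivity
    rw [radius_sq, NNReal.coe_one]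
    exact le_of_eq (by field_simp)
  have hexp : Real.exp (-logFactor K T) = 1 / (T ^ 4 * K) := by
    rw [Real.exp_neg, logFactor, Real.exp_add, Real.exp_log hK0, ← Nat.cast_ofNat,
      Real.exp_nat_mul, Real.exp_log hT0, one_div]
  refine ENNReal.toReal_le_of_le_ofReal (by positivity) ?_
  refine (measure_not_concentrated_le hξ.isSubgaussianInnovation
    (fun t => hξ.measurable_runArm (radius K T) t) (fun _ => Real.sqrt_nonneg _) hκ).trans_eq ?_
  rw [Fintype.card_fin, hexp]
  rw [← ENNReal.ofReal_natCast K, ← ENNReal.ofReal_natCast T, ← ENNReal.ofReal_pow hT0.le,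
    ← ENNReal.ofReal_ofNat 2, ← ENNReal.ofReal_mul hK0.le, ← ENNReal.ofReal_mul zero_le_two,
    ← ENNReal.ofReal_mul (by positivity)]
  congr 1
  field_simp

theorem IsNoise.regret_le [IsProbabilityMeasure P] (hξ : IsNoise P ξ) (hT : 1 ≤ T)
    (hμ : ∀ t ∈ Finset.Icc 1 T, ∀ a, S - μ t a ≤ 1) (hS : Realizable S μ T) :
    regret P S T (nonstationarySat K T S order) μ ξ ≤
      (16 * logFactor K T + 5) * complexity S μ T := by
  have hT0 : (0 : ℝ) < T := by exact_mod_cast hT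
  have hκ : 0 ≤ logFactor K T := logFactor_nonneg K T
  have hX : 0 ≤ complexity S μ T := complexity_nonneg
  calc _ ≤ (16 * logFactor K T + 3) * complexity S μ T + P.real {ω | ¬Concentrated (radius K T)
        (runArm S (radius K T) order fun τ a => μ (τ + 1) a + ξ (τ + 1) ω a)
        (fun τ => ξ (τ + 1) ω) T} * (T * complexity S μ T) :=
        integral_le_add_measureReal_mul (hξ.integrable_shortfall hT hμ) (by positivity)
          (fun ω => shortfall_le_mul_complexity hT hμ _)
          fun ω hω => shortfall_le_of_concentrated hT hμ hS (not_not.1 hω)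
    _ ≤ (16 * logFactor K T + 3) * complexity S μ T + 2 / T * (T * complexity S μ T) := by
        gcongr
        exact hξ.measureReal_not_concentrated_le hT
    _ = (16 * logFactor K T + 5) * complexity S μ T := by
        rw [← mul_assoc, div_mul_cancel₀ _ hT0.ne']
        ring

end Noise

section Constant

theorem logFactor_le {c : ℝ} {K T : ℕ} [NeZero K] (hT : 2 ≤ T) (hKT : (K : ℝ) ≤ c * T) :
    16 * logFactor K T + 5 ≤ (90 + 32 * |Real.log c|) * Real.log T := by
  have hT0 : (0 : ℝ) < T := by positivity
  have hK0 : (0 : ℝ) < K := by exact_mod_cast NeZero.pos K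
  have hc : 0 < c := pos_of_mul_pos_left (hK0.trans_le hKT) hT0.le
  have hlogT : 1 ≤ 2 * Real.log T := by
    have hlog2 : Real.log 2 ≤ Real.log T := Real.log_le_log two_pos (by exact_mod_cast hT)
    linarith [Real.log_two_gt_d9]
  have hlogK : Real.log K ≤ Real.log c + Real.log T := by
    rw [← Real.log_mul hc.ne' hT0.ne']
    exact Real.log_le_log hK0 hKT
  have hlogc : Real.log c ≤ |Real.log c| * (2 * Real.log T) :=
    (le_abs_self _).trans (le_mul_of_one_le_right (abs_nonneg _) hlogT)
  rw [logFactor]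
  linarith

theorem Realizable.sub_le_one {K T : ℕ} [NeZero K] {S : ℝ} {μ : ℕ → Fin K → ℝ}
    (hS : Realizable S μ T) (hT : 1 ≤ T)
    (hμ : ∀ t ∈ Finset.Icc 1 T, ∀ a, μ t a ∈ Set.Icc (0 : ℝ) 1) :
    ∀ t ∈ Finset.Icc 1 T, ∀ a, S - μ t a ≤ 1 := by
  have hpos : 0 < numSegments μ T := by
    rw [numSegments, numSegmentsOn]
    positivity
  have hS1 : S < 1 := (hS 0 hpos).trans_le
    (ciSup_le fun a => (hμ _ (changePoint_mem_Icc μ hT hpos) a).2)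
  intro t ht a
  linarith [(hμ t ht a).1]

end Constant

end SatBandit

theorem theorem3_general {K T : ℕ} [NeZero K] (hT : 1 ≤ T) {S : ℝ} (order : Equiv.Perm (Fin K))
    {μ : ℕ → Fin K → ℝ} (hμ : ∀ t ∈ Finset.Icc 1 T, ∀ a, S - μ t a ≤ 1)
    (hS : SatBandit.Realizable S μ T) {Ω : Type*} [MeasurableSpace Ω] {P : Measure Ω}
    [IsProbabilityMeasure P] {ξ : ℕ → Ω → Fin K → ℝ} (hξ : SatBandit.IsNoise P ξ) :
    Integrable (SatBandit.shortfall S T (SatBandit.nonstationarySat K T S order) μ ξ) P ∧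
      SatBandit.regret P S T (SatBandit.nonstationarySat K T S order) μ ξ ≤
        (16 * SatBandit.logFactor K T + 5) * SatBandit.complexity S μ T :=
  ⟨hξ.integrable_shortfall hT hμ, hξ.regret_le hT hμ hS⟩

theorem theorem3 (c : ℝ) :
    ∃ C : ℝ, 0 < C ∧
      ∀ (K T : ℕ) [NeZero K], 2 ≤ T → (K : ℝ) ≤ c * (T : ℝ) →
      ∀ (S : ℝ) (order : Equiv.Perm (Fin K)) (μ : ℕ → Fin K → ℝ),
        (∀ t ∈ Finset.Icc 1 T, ∀ a, μ t a ∈ Set.Icc (0 : ℝ) 1) →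
        SatBandit.Realizable S μ T →
      ∀ (Ω : Type*) [MeasurableSpace Ω] (P : MeasureTheory.Measure Ω)
        [MeasureTheory.IsProbabilityMeasure P] (ξ : ℕ → Ω → Fin K → ℝ),
        SatBandit.IsNoise P ξ →
        MeasureTheory.Integrable
          (SatBandit.shortfall S T (SatBandit.nonstationarySat K T S order) μ ξ) P ∧
        SatBandit.regret P S T (SatBandit.nonstationarySat K T S order) μ ξ ≤
          C * ((∑ l ∈ Finset.range (SatBandit.numSegments μ T),
            ∑ a ∈ Finset.univ.filter (fun a => SatBandit.segMean μ T l a < S),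
              (1 / SatBandit.gap S μ T l a
                + SatBandit.gap S μ T l a / (SatBandit.bestGap S μ T l) ^ 2)) *
            Real.log T) := by
  refine ⟨90 + 32 * |Real.log c|, by positivity, ?_⟩
  intro K T _ hT hKT S order μ hμ hS Ω _ P _ ξ hξ
  have hT1 : 1 ≤ T := one_le_two.trans hT
  refine (theorem3_general hT1 order (hS.sub_le_one hT1 hμ) hS hξ).imp_right fun hregret => ?_
  calc _ ≤ (16 * SatBandit.logFactor K T + 5) * SatBandit.complexity S μ T := hregret
    _ ≤ (90 + 32 * |Real.log c|) * Real.log T * SatBandit.complexity S μ T :=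
        mul_le_mul_of_nonneg_right (SatBandit.logFactor_le hT hKT) SatBandit.complexity_nonneg
    _ = (90 + 32 * |Real.log c|) * (SatBandit.complexity S μ T * Real.log T) := by ring
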